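/- Let $(\mathbb B,\|\cdot\|)$ be a separable real Banach space that is $r$-smooth for some $r\in(1,2]$, i.e. there is an equivalent norm $\|\cdot\|'$ on $\mathbb B$ with $$\sup_{t>0}\ \sup_{\|x\|'=\|y\|'=1}\frac{\|x+ty\|'+\|x-ty\|'-2}{t^r}<\infty .$$ Let $m\ge 1$ be an integer and $p\in(1,r]$. For $n\ge m$ put $\operatorname{Inc}_n^m=\{\mathbf i=(i_1,\dots,i_m)\in\mathbb N^m: 1\le i_1<\dots<i_m\le n\}$. For every real $q\ge p$ there is a finite constant $K=K(m,p,q,\mathbb B)$, depending only on $m,p,q$ and $\mathbb B$, such that the following holds. Let $(\xi_i)_{i\ge1}$ be an i.i.d. sequence with values in a measurable space $(S,\mathcal S)$, write $\xi_J=(\xi_j)_{j\in J}$ and $\xi_{\mathbf i}=(\xi_{i_1},\dots,\xi_{i_m})$, and for every $\mathbf i=(i_1,\dots,i_m)$ with $1\le i_1<\dots<i_m$ let $h_{\mathbf i}\colon S^m\to\mathbb B$ be measurable, with $h_{\mathbf i}(\xi_1,\dots,\xi_m)$ integrable, and degenerated: for each $\ell_0\in\{1,\dots,m\}$, $$\mathbb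 E\big[h_{\mathbf i}(\xi_1,\dots,\xi_m)\mid \xi_{\{1,\dots,m\}\setminus\{\ell_0\}}\big]=0\quad\text{almost surely.}$$ Let $U_n=\sum_{\mathbf i\in\operatorname{Inc}_n^m}h_{\mathbf i}(\xi_{\mathbf i})$. Then for every $N\ge m$, as an inequality in $[0,\infty]$, $$\begin{aligned}\mathbb E\max_{m\le n\le N}\|U_n\|^q\le{}& K\sum_{\mathbf i\in\operatorname{Inc}_N^m}\mathbb E\|h_{\mathbf i}(\xi_1,\dots,\xi_m)\|^q\\ &+K\sum_{\emptyset\subsetneq J\subsetneq\{1,\dots,m\}}\ \sum_{a\in\mathbb N^J}\mathbb E\Bigg[\bigg(\sum_{\mathbf i\in\operatorname{Inc}_N^m:\ i_j=a_j\ \forall j\in J}\mathbb E\big[\|h_{\mathbf i}(\xi_1,\dots,\xi_m)\|^p\mid\xi_J\big]\bigg)^{q/p}\Bigg]\\ &+K\bigg(\sum_{\mathbf i\in\operatorname{Inc}_N^m}\mathbb E\|h_{\mathbf i}(\xi_1,\dots,\xi_m)\|^p\bigg)^{q/p}.\end{aligned}$$ In particular, for $q=p$, there is a finite constant $K(m,p,\mathbb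 B)$, depending only on $m,p$ and $\mathbb B$, such that in the same setting $$\mathbb E\max_{m\le n\le N}\|U_n\|^p\le K(m,p,\mathbb B)\sum_{\mathbf i\in\operatorname{Inc}_N^m}\mathbb E\|h_{\mathbf i}(\xi_1,\dots,\xi_m)\|^p .$$ -/

import Mathlib

open MeasureTheory ProbabilityTheory
open scoped ENNReal NNReal

universe u v w

/-- `r`-smoothness of a real Banach space: some equivalent norm `nu` satisfies
`sup_{t > 0} sup_{nu x = nu y = 1} (nu (x + t y) + nu (x - t y) - 2) / t ^ r < ∞`. -/
def IsRSmooth (B : Type w) [NormedAddCommGroup B] [NormedSpace ℝ B] (r : ℝ) : Prop :=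
  ∃ nu : Seminorm ℝ B,
    (∃ a b : ℝ, 0 < a ∧ 0 < b ∧ ∀ x : B, a * ‖x‖ ≤ nu x ∧ nu x ≤ b * ‖x‖) ∧
    ∃ C : ℝ, ∀ t : ℝ, 0 < t → ∀ x y : B, nu x = 1 → nu y = 1 →
      (nu (x + t • y) + nu (x - t • y) - 2) / t ^ r ≤ C

/-- The strictly increasing `m`-tuples of indices among the first `n` indices. Indices start
at `0`, so that these are the tuples `0 ≤ i 0 < ⋯ < i (m - 1) ≤ n - 1`. -/
noncomputable def Inc (m n : ℕ) : Finset (Fin m → ℕ) :=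
  open Classical in (Fintype.piFinset fun _ : Fin m => Finset.range n).filter StrictMono

section

variable {Ω : Type u} [MeasurableSpace Ω] {S : Type v} [MeasurableSpace S]

/-- `ξ` is an i.i.d. sequence of random variables with values in the measurable space `S`. -/
structure IsIIDSeq (ξ : ℕ → Ω → S) (P : Measure Ω) : Prop where
  measurable : ∀ i, Measurable (ξ i)
  indep : iIndepFun ξ P
  identDistrib : ∀ i, IdentDistrib (ξ i) (ξ 0) P P

/-- The vector of the first `m` variables of the sequence. -/
def firstVars (ξ : ℕ → Ω → S) (m : ℕ) (ω : Ω) : Fin m → S := fun l => ξ l ω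

/-- The σ-algebra generated by the variables `ξ j`, `j ∈ J`, where `J` is a set of positions
among the first `m` ones. -/
abbrev sigmaOf (ξ : ℕ → Ω → S) {m : ℕ} (J : Finset (Fin m)) : MeasurableSpace Ω :=
  MeasurableSpace.comap (fun (ω : Ω) (j : J) => ξ (j : Fin m) ω) MeasurableSpace.pi

variable {B : Type w} [NormedAddCommGroup B] [NormedSpace ℝ B]

/-- The kernel `h` is degenerated with respect to `ξ`: `h (ξ_1, …, ξ_m)` is integrable, and its
conditional expectation given all but any one of the variables `ξ_1, …, ξ_m` vanishes. -/
structure IsDegenerated [CompleteSpace B] {m : ℕ} (h : (Fin m → S) → B) (ξ : ℕ → Ω → S)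
    (P : Measure Ω) : Prop where
  integrable : Integrable (fun ω => h (firstVars ξ m ω)) P
  condExp_eq_zero : ∀ l : Fin m,
    P[fun ω => h (firstVars ξ m ω) | sigmaOf ξ ({l}ᶜ : Finset (Fin m))] =ᵐ[P] 0

/-- The `U`-statistic `U_n = ∑_{i ∈ Inc_n^m} h_i (ξ_{i_1}, …, ξ_{i_m})`. -/
noncomputable def UStat {m : ℕ} (h : (Fin m → ℕ) → (Fin m → S) → B) (ξ : ℕ → Ω → S) (n : ℕ)
    (ω : Ω) : B :=
  ∑ i ∈ Inc m n, h i fun l => ξ (i l) ω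

/-- `E [max_{m ≤ n ≤ N} ‖U_n‖ ^ q]`, with values in `[0, ∞]`. -/
noncomputable def maxMoment {m : ℕ} (h : (Fin m → ℕ) → (Fin m → S) → B) (ξ : ℕ → Ω → S)
    (P : Measure Ω) (N : ℕ) (q : ℝ) : ℝ≥0∞ :=
  ∫⁻ ω, (Finset.Icc m N).sup (fun n => ‖UStat h ξ n ω‖ₑ ^ q) ∂P

/-- `∑_{i ∈ Inc_N^m} E [‖h_i (ξ_1, …, ξ_m)‖ ^ q]`, with values in `[0, ∞]`. -/
noncomputable def sumMoments {m : ℕ} (h : (Fin m → ℕ) → (Fin m → S) → B) (ξ : ℕ → Ω → S)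
    (P : Measure Ω) (N : ℕ) (q : ℝ) : ℝ≥0∞ :=
  ∑ i ∈ Inc m N, ∫⁻ ω, ‖h i (firstVars ξ m ω)‖ₑ ^ q ∂P

/-- For a set `J` of positions and values `a` of the indices at these positions, the random
variable `∑ E [‖h_i (ξ_1, …, ξ_m)‖ ^ p | ξ_J]`, where the sum runs over the `i ∈ Inc_N^m` that
agree with `a` on `J`. The conditional expectation is that of a `[0, ∞]`-valued variable. -/
noncomputable def condMomentSum {m : ℕ} (h : (Fin m → ℕ) → (Fin m → S) → B) (ξ : ℕ → Ω → S)
    (P : Measure Ω) (N : ℕ) (p : ℝ) (J : Finset (Fin m)) (a : J → ℕ) (ω : Ω) : ℝ≥0∞ :=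
  open Classical in
  ∑ i ∈ (Inc m N).filter (fun i => ∀ j : J, i j = a j),
    condLExp (sigmaOf ξ J) P (fun ω' => ‖h i (firstVars ξ m ω')‖ₑ ^ p) ω

end

/-! The sum `U_N` is treated as an iterated martingale, and a Rosenthal inequality with exponent `σ
= q / p` is applied once for each of the `m` arguments of the kernel.

Smoothness gives an equivalent norm with `nu (x + y) ^ p + nu (x - y) ^ p ≤ 2 * nu x ^ p + C * nu y
^ p` (`IsRSmooth.exists_two_point`). This inequality can be integrated, so it passes to `L^p(ν; B)`
with the same constant, whatever the measure `ν`. Raised to the power `σ` and averaged over a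
centered increment, it bounds the growth of the moment of order `pσ` of a martingale in one step
(`Seminorm.exists_one_step`). Summing the steps and controlling the mixed terms by the inequalities
of Young and Doob yields, with `‖·‖` the norm of `L^p(ν; B)`, the bound `E‖∑ D_k‖^{pσ} ≤ K (∑
E‖D_k‖^{pσ} + E(∑ E_k‖D_k‖^p)^σ)`, where `E_k` averages over the `k`-th variable only
(`Seminorm.exists_rosenthal`).

In `U_N` the terms with largest index `k` form a martingale difference: the kernel is centered in
its last argument, and the other arguments only involve variables with index below `k`. Rosenthal's
inequality replaces the sum over `k` by one of two expressions: the sum and the integral over the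
last argument stand either outside the power `σ` or inside it. In the second case the sum over the
other indices takes values in an `L^p` space over the last argument, which is why the inequality is
needed for `L^p(ν; B)` with arbitrary `ν`. After `m` applications there is one mixed norm for every
set `J` of arguments left outside the power (`Seminorm.exists_partialSum_moment`).

By independence, integrating out the arguments outside `J` is conditioning on `ξ_J`. The set `J` of
all arguments then gives the sum of `q`-th moments, `J = ∅` gives the last term of the claim, and
the proper nonempty sets give the middle one. The maximum over `n` costs one more application of
Doob's inequality. All estimates are made on the space of sequences with product measure, with
kernels that are centered everywhere; `exists_ae_eq_centered` provides these by a change on a null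
set. -/

/-! ### Elementary inequalities for real powers -/

/-- Powers are Lipschitz at `1` on bounded intervals. -/
theorem exists_abs_rpow_sub_one_le (γ L : ℝ) (hγ : 0 ≤ γ) (hL : 1 ≤ L) :
    ∃ c : ℝ, 0 ≤ c ∧ ∀ y : ℝ, 0 ≤ y → y ≤ L → |y ^ γ - 1| ≤ c * |y - 1| := by
  rcases le_total γ 1 with h1 | h1
  · refine ⟨1, zero_le_one, fun y hy _ => ?_⟩
    rw [one_mul]
    rcases le_total y 1 with hy1 | hy1
    · have h2 : y ≤ y ^ γ := by
        simpa using Real.rpow_le_rpow_of_exponent_ge' hy hy1 hγ h1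
      have h3 : y ^ γ ≤ 1 := Real.rpow_le_one hy hy1 hγ
      rw [abs_of_nonpos (by linarith), abs_of_nonpos (by linarith)]
      linarith
    · have h2 : y ^ γ ≤ y := by
        simpa using Real.rpow_le_rpow_of_exponent_le hy1 h1
      have h3 : 1 ≤ y ^ γ := Real.one_le_rpow hy1 hγ
      rw [abs_of_nonneg (by linarith), abs_of_nonneg (by linarith)]
      linarith
  · have hLp : 1 ≤ L ^ (γ - 1) := Real.one_le_rpow hL (by linarith)
    refine ⟨γ * L ^ (γ - 1), by positivity, fun y hy hyL => ?_⟩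
    rcases le_total y 1 with hy1 | hy1
    · have h2 := one_add_mul_self_le_rpow_one_add (s := y - 1) (by linarith) h1
      have h3 : y ^ γ ≤ 1 := Real.rpow_le_one hy hy1 hγ
      rw [abs_of_nonpos (by linarith), abs_of_nonpos (by linarith)]
      have h4 : 1 + (y - 1) = y := by ring
      rw [h4] at h2
      nlinarith [mul_nonneg (mul_nonneg hγ (sub_nonneg.2 hy1)) (sub_nonneg.2 hLp)]
    · have hy0 : 0 < y := by linarith
      -- Bernoulli's inequality at `1 / y`, multiplied by `y ^ γ`, gives the upper bound `y ^ γ - 1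
      -- ≤ γ * y ^ (γ - 1) * (y - 1)`.
      have h2 := one_add_mul_self_le_rpow_one_add (s := 1 / y - 1)
        (by have : 0 < 1 / y := by positivity
            linarith) h1
      have h4 : 1 + (1 / y - 1) = y⁻¹ := by ring
      rw [h4, Real.inv_rpow hy] at h2
      have h3 : 1 ≤ y ^ γ := Real.one_le_rpow hy1 hγ
      have h5 : y ^ γ = y * y ^ (γ - 1) := by
        rw [← Real.rpow_one_add' hy (by linarith)]; ring_nf
      have h6 : y ^ (γ - 1) ≤ L ^ (γ - 1) := Real.rpow_le_rpow hy hyL (by linarith)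
      have h7 : y ^ γ * (1 + γ * (1 / y - 1)) ≤ 1 := by
        calc _ ≤ y ^ γ * (y ^ γ)⁻¹ := by gcongr
          _ = 1 := mul_inv_cancel₀ (by positivity)
      have h8 : y ^ γ * (1 + γ * (1 / y - 1)) = y ^ γ - γ * y ^ (γ - 1) * (y - 1) := by
        rw [h5]; field_simp; ring
      rw [abs_of_nonneg (by linarith), abs_of_nonneg (by linarith)]
      have h9 : γ * y ^ (γ - 1) * (y - 1) ≤ γ * L ^ (γ - 1) * (y - 1) := by
        have : 0 ≤ y - 1 := by linarith
        gcongr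
      linarith

/-- A second order upper bound for powers near `1`. -/
theorem exists_rpow_le_taylor (β L : ℝ) (hβ : 1 ≤ β) (hL : 1 ≤ L) :
    ∃ c : ℝ, 0 ≤ c ∧ ∀ y : ℝ, 0 ≤ y → y ≤ L → y ^ β ≤ 1 + β * (y - 1) + c * (y - 1) ^ 2 := by
  obtain ⟨c, hc, h⟩ := exists_abs_rpow_sub_one_le (β - 1) L (by linarith) hL
  -- Bernoulli at `1 / y` gives `y ^ β ≤ 1 + β * y ^ (β - 1) * (y - 1)`, and replacing `y ^ (β - 1)`
  -- by `1` costs `β * c * (y - 1) ^ 2`. The extra `β` is there for `y = 0`.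
  refine ⟨β * c + β, by positivity, fun y hy hyL => ?_⟩
  rcases hy.eq_or_lt with rfl | hy0
  · rw [Real.zero_rpow (by linarith)]
    have : 0 ≤ β * c := by positivity
    nlinarith
  have h2 := one_add_mul_self_le_rpow_one_add (s := 1 / y - 1)
    (by have : 0 < 1 / y := by positivity
        linarith) hβ
  have h4 : 1 + (1 / y - 1) = y⁻¹ := by ring
  rw [h4, Real.inv_rpow hy] at h2
  have h5 : y ^ β = y * y ^ (β - 1) := by
    rw [← Real.rpow_one_add' hy (by linarith)]; ring_nf
  have hpos : 0 < y ^ β := Real.rpow_pos_of_pos hy0 _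
  have h7 : y ^ β * (1 + β * (1 / y - 1)) ≤ 1 := by
    calc _ ≤ y ^ β * (y ^ β)⁻¹ := by gcongr
      _ = 1 := mul_inv_cancel₀ (by positivity)
  have h8 : y ^ β * (1 + β * (1 / y - 1)) = y ^ β - β * y ^ (β - 1) * (y - 1) := by
    rw [h5]; field_simp; ring
  have h9 : (y ^ (β - 1) - 1) * (y - 1) ≤ c * (y - 1) ^ 2 := by
    calc _ ≤ |(y ^ (β - 1) - 1) * (y - 1)| := le_abs_self _
      _ = |y ^ (β - 1) - 1| * |y - 1| := abs_mul _ _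
      _ ≤ c * |y - 1| * |y - 1| := by gcongr; exact h y hy hyL
      _ = c * (y - 1) ^ 2 := by rw [mul_assoc, ← pow_two, sq_abs]
  have h10 : β * ((y ^ (β - 1) - 1) * (y - 1)) ≤ β * (c * (y - 1) ^ 2) := by gcongr
  nlinarith [mul_nonneg (by linarith : (0 : ℝ) ≤ β) (sq_nonneg (y - 1))]

/-- Raising a two-point smoothness inequality to a power: if `u, v` are within `b` of `a` and
`u ^ α + v ^ α ≤ 2 a ^ α + C a ^ α (b / a) ^ p` for `b ≤ a`, then an inequality of the same kind
holds with the exponent `α * β`. -/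
theorem exists_two_point_rpow (α β p C : ℝ) (hα : 1 ≤ α) (hβ : 1 ≤ β) (hp2 : p ≤ 2)
    (hC : 0 ≤ C) : ∃ C' : ℝ, 0 ≤ C' ∧ ∀ a b u v : ℝ, 0 ≤ a → 0 ≤ b → 0 ≤ u → 0 ≤ v →
      |u - a| ≤ b → |v - a| ≤ b →
      (0 < b → b ≤ a → u ^ α + v ^ α ≤ a ^ α * (2 + C * (b / a) ^ p)) →
      u ^ (α * β) + v ^ (α * β) ≤
        2 * a ^ (α * β) + C' * (a ^ (α * β - p) * b ^ p + b ^ (α * β)) := by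
  obtain ⟨c₁, hc₁, h₁⟩ := exists_abs_rpow_sub_one_le α 2 (by linarith) (by norm_num)
  obtain ⟨c₂, hc₂, h₂⟩ := exists_rpow_le_taylor β (2 ^ α) hβ
    (Real.one_le_rpow (by norm_num) (by linarith))
  -- In the constant below, the first two terms serve the case `b ≤ a`, by Taylor expansion at `a`.
  -- The last one serves `a < b`, where `u` and `v` are at most `2 * b`.
  have hq : 0 < α * β := by positivity
  refine ⟨β * C + 2 * (c₂ * c₁ ^ 2) + 2 * 2 ^ (α * β), by positivity,
    fun a b u v ha hb hu hv hua hva hyp => ?_⟩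
  set K := β * C + 2 * (c₂ * c₁ ^ 2) with hK
  have hK0 : 0 ≤ K := by positivity
  have hu' := abs_le.1 hua
  have hv' := abs_le.1 hva
  have hX : 0 ≤ a ^ (α * β - p) * b ^ p := by positivity
  have hY : 0 ≤ b ^ (α * β) := by positivity
  have hZ : 0 ≤ a ^ (α * β) := by positivity
  have hT : (0 : ℝ) ≤ 2 ^ (α * β) := by positivity
  rcases hb.eq_or_lt with rfl | hb0
  · have e1 : u = a := by linarith
    have e2 : v = a := by linarith
    rw [e1, e2]
    have : 0 ≤ (K + 2 * 2 ^ (α * β)) * (a ^ (α * β - p) * 0 ^ p + 0 ^ (α * β)) := by positivity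
    linarith
  rcases lt_or_ge a b with hab | hab
  · have hu2 : u ^ (α * β) ≤ 2 ^ (α * β) * b ^ (α * β) := by
      rw [← Real.mul_rpow (by norm_num) hb]
      exact Real.rpow_le_rpow hu (by linarith) hq.le
    have hv2 : v ^ (α * β) ≤ 2 ^ (α * β) * b ^ (α * β) := by
      rw [← Real.mul_rpow (by norm_num) hb]
      exact Real.rpow_le_rpow hv (by linarith) hq.le
    nlinarith [mul_nonneg hK0 hX, mul_nonneg hK0 hY, mul_nonneg hT hX]
  · have ha0 : 0 < a := by linarith
    have hyp := hyp hb0 hab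
    -- Taylor expansion of the `β`-th power at `y = (x / a) ^ α`. The quadratic error is at most a
    -- multiple of `(b / a) ^ 2`, hence of `(b / a) ^ p`, because `b / a ≤ 1` and `p ≤ 2`.
    have key : ∀ x : ℝ, 0 ≤ x → |x - a| ≤ b → x ^ (α * β) ≤ a ^ (α * β) *
        (1 + β * ((x / a) ^ α - 1) + c₂ * (c₁ ^ 2 * (b / a) ^ p)) := by
      intro x hx hxa
      have hxa' := abs_le.1 hxa
      have e1 : x ^ (α * β) = a ^ (α * β) * ((x / a) ^ α) ^ β := by
        rw [← Real.rpow_mul (by positivity), ← Real.mul_rpow ha (by positivity)]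
        congr 1; field_simp
      rw [e1]
      have hx2 : x / a ≤ 2 := by rw [div_le_iff₀ ha0]; linarith
      have h3 := h₂ ((x / a) ^ α) (by positivity)
        (Real.rpow_le_rpow (by positivity) hx2 (by linarith))
      have h4 := h₁ (x / a) (by positivity) hx2
      have h5 : |x / a - 1| ≤ b / a := by
        rw [div_sub_one ha0.ne', abs_div, abs_of_pos ha0]
        gcongr
      have h6 : ((x / a) ^ α - 1) ^ 2 ≤ c₁ ^ 2 * (b / a) ^ p := by
        calc ((x / a) ^ α - 1) ^ 2 = |(x / a) ^ α - 1| ^ 2 := (sq_abs _).symm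
          _ ≤ (c₁ * (b / a)) ^ 2 := by
            gcongr
            exact h4.trans (by gcongr)
          _ = c₁ ^ 2 * (b / a) ^ (2 : ℝ) := by rw [mul_pow, Real.rpow_two]
          _ ≤ c₁ ^ 2 * (b / a) ^ p := by
            gcongr ?_ * ?_
            exact Real.rpow_le_rpow_of_exponent_ge (by positivity) (div_le_one_of_le₀ hab ha) hp2
      gcongr
      exact h3.trans (by gcongr)
    have hsum : (u / a) ^ α + (v / a) ^ α ≤ 2 + C * (b / a) ^ p := by
      rw [Real.div_rpow hu ha, Real.div_rpow hv ha, ← add_div, div_le_iff₀ (by positivity)]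
      linarith
    have hXe : a ^ (α * β - p) * b ^ p = a ^ (α * β) * (b / a) ^ p := by
      rw [Real.rpow_sub ha0, Real.div_rpow hb ha]; field_simp
    calc u ^ (α * β) + v ^ (α * β)
        ≤ a ^ (α * β) * (1 + β * ((u / a) ^ α - 1) + c₂ * (c₁ ^ 2 * (b / a) ^ p)) +
          a ^ (α * β) * (1 + β * ((v / a) ^ α - 1) + c₂ * (c₁ ^ 2 * (b / a) ^ p)) :=
          add_le_add (key u hu hua) (key v hv hva)
      _ = a ^ (α * β) * (2 + β * ((u / a) ^ α + (v / a) ^ α - 2)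
            + 2 * c₂ * c₁ ^ 2 * (b / a) ^ p) := by ring
      _ ≤ a ^ (α * β) * (2 + β * (C * (b / a) ^ p) + 2 * c₂ * c₁ ^ 2 * (b / a) ^ p) := by
          gcongr; linarith
      _ = 2 * a ^ (α * β) + K * (a ^ (α * β - p) * b ^ p) := by rw [hXe]; ring
      _ ≤ _ := by nlinarith [mul_nonneg hK0 hY, mul_nonneg hT hX, mul_nonneg hT hY]

/-! ### The two-point inequality in `B` and in `L^p(ν; B)` -/

/-- In an `r`-smooth space the `p`-th power, `p ≤ r`, of an equivalent norm satisfies a two-point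
inequality. -/
theorem IsRSmooth.exists_two_point {B : Type w} [NormedAddCommGroup B] [NormedSpace ℝ B] {r p : ℝ}
    (hB : IsRSmooth B r) (hp1 : 1 < p) (hpr : p ≤ r) (hr2 : r ≤ 2) :
    ∃ nu : Seminorm ℝ B, (∃ a b : ℝ, 0 < a ∧ 0 < b ∧ ∀ x : B, a * ‖x‖ ≤ nu x ∧ nu x ≤ b * ‖x‖) ∧
      ∃ C : ℝ, 0 ≤ C ∧ ∀ x y : B, nu (x + y) ^ p + nu (x - y) ^ p ≤ 2 * nu x ^ p + C * nu y ^ p := by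
  obtain ⟨nu, hnu, C, hC⟩ := hB
  -- With `α = 1` and `β = p` both error terms equal `nu y ^ p`, whence the constant `2 * C'`.
  obtain ⟨C', hC', h⟩ := exists_two_point_rpow 1 p p (max C 0) le_rfl hp1.le
    (by linarith) (le_max_right _ _)
  refine ⟨nu, hnu, 2 * C', by positivity, fun x y => ?_⟩
  have h1 := h (nu x) (nu y) (nu (x + y)) (nu (x - y)) (apply_nonneg _ _) (apply_nonneg _ _)
    (apply_nonneg _ _) (apply_nonneg _ _) ?_ ?_ ?_
  · simp only [one_mul, sub_self, Real.rpow_zero] at h1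
    linarith
  · have := abs_sub_map_le_sub nu (x + y) x
    simpa using this
  · have := abs_sub_map_le_sub nu (x - y) x
    simpa using this
  · intro hy hyx
    have hx : 0 < nu x := hy.trans_le hyx
    -- Smoothness at the normalized vectors, with `t = nu y / nu x ≤ 1`; as `t ≤ 1`, the exponent
    -- `r` may be lowered to `p`.
    have h2 := hC (nu y / nu x) (by positivity) ((nu x)⁻¹ • x) ((nu y)⁻¹ • y)
      (by rw [map_smul_eq_mul, Real.norm_of_nonneg (by positivity)]; field_simp)
      (by rw [map_smul_eq_mul, Real.norm_of_nonneg (by positivity)]; field_simp)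
    have e1 : (nu y / nu x) • ((nu y)⁻¹ • y) = (nu x)⁻¹ • y := by
      rw [smul_smul]; congr 1; field_simp
    rw [e1, ← smul_add, ← smul_sub, map_smul_eq_mul, map_smul_eq_mul,
      Real.norm_of_nonneg (by positivity), div_le_iff₀ (by positivity)] at h2
    have h3 : (nu y / nu x) ^ r ≤ (nu y / nu x) ^ p :=
      Real.rpow_le_rpow_of_exponent_ge (by positivity) (div_le_one_of_le₀ hyx hx.le) hpr
    have h4 : C * (nu y / nu x) ^ r ≤ max C 0 * (nu y / nu x) ^ p := by
      gcongr
      exact le_max_left _ _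
    simp only [Real.rpow_one]
    have h5 : (nu x)⁻¹ * nu (x + y) + (nu x)⁻¹ * nu (x - y) ≤
        2 + max C 0 * (nu y / nu x) ^ p := by linarith
    calc nu (x + y) + nu (x - y)
        = nu x * ((nu x)⁻¹ * nu (x + y) + (nu x)⁻¹ * nu (x - y)) := by field_simp
      _ ≤ _ := by gcongr

/-- Jensen's inequality for powers of `[0, ∞]`-valued functions. -/
theorem lintegral_rpow_le_lintegral_rpow {T : Type*} [MeasurableSpace T] {μ : Measure T}
    [IsProbabilityMeasure μ] {f : T → ℝ≥0∞} (hf : AEMeasurable f μ) {s : ℝ} (hs : 1 ≤ s) :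
    (∫⁻ t, f t ∂μ) ^ s ≤ ∫⁻ t, f t ^ s ∂μ := by
  rcases hs.eq_or_lt with rfl | hs1
  · simp
  have h := ENNReal.lintegral_mul_le_Lp_mul_Lq μ (Real.HolderConjugate.conjExponent hs1) hf
    (aemeasurable_const (b := (1 : ℝ≥0∞)))
  simp only [Pi.mul_apply, mul_one, ENNReal.one_rpow, lintegral_const, measure_univ] at h
  calc (∫⁻ t, f t ∂μ) ^ s ≤ ((∫⁻ t, f t ^ s ∂μ) ^ (1 / s)) ^ s := by gcongr
    _ = _ := by rw [← ENNReal.rpow_mul, one_div_mul_cancel (by linarith), ENNReal.rpow_one]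

/-- The two-point inequality `exists_two_point_rpow` for `p`-th powers of elements of `[0, ∞]`. -/
theorem exists_two_point_ennreal (p σ C : ℝ) (hp1 : 1 < p) (hp2 : p ≤ 2) (hσ : 1 ≤ σ)
    (hC : 0 ≤ C) : ∃ C' : ℝ≥0, ∀ W w U V : ℝ≥0∞,
      U ^ (1 / p) ≤ W ^ (1 / p) + w ^ (1 / p) → W ^ (1 / p) ≤ U ^ (1 / p) + w ^ (1 / p) →
      V ^ (1 / p) ≤ W ^ (1 / p) + w ^ (1 / p) → W ^ (1 / p) ≤ V ^ (1 / p) + w ^ (1 / p) →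
      U + V ≤ 2 * W + ENNReal.ofReal C * w →
      U ^ σ + V ^ σ ≤ 2 * W ^ σ + C' * (W ^ (σ - 1) * w + w ^ σ) := by
  obtain ⟨C', hC', h⟩ := exists_two_point_rpow p σ p C hp1.le hσ hp2 hC
  have hp0 : 0 < p := by linarith
  have hσ0 : 0 < σ := by linarith
  -- Adding `1` makes the constant nonzero, so that the right-hand side is infinite when `w = ∞`.
  refine ⟨C'.toNNReal + 1, fun W w U V hUW hWU hVW hWV hsum => ?_⟩
  by_cases hW : W = ∞
  · simp [hW, ENNReal.top_rpow_of_pos hσ0, ENNReal.mul_top]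
  by_cases hw : w = ∞
  · simp [hw, ENNReal.top_rpow_of_pos hσ0, ENNReal.mul_top]
  have hUV : U + V ≠ ∞ := ne_top_of_le_ne_top (by finiteness) hsum
  have hU : U ≠ ∞ := fun h => hUV (by simp [h])
  have hV : V ≠ ∞ := fun h => hUV (by simp [h])
  lift W to ℝ≥0 using hW
  lift w to ℝ≥0 using hw
  lift U to ℝ≥0 using hU
  lift V to ℝ≥0 using hV
  rw [← ENNReal.ofReal_coe_nnreal (p := W), ← ENNReal.ofReal_coe_nnreal (p := w),
    ← ENNReal.ofReal_coe_nnreal (p := U), ← ENNReal.ofReal_coe_nnreal (p := V)] at *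
  have hp' : 0 ≤ 1 / p := by positivity
  have hσ1 : 0 ≤ σ - 1 := by linarith
  have e2 : (2 : ℝ≥0∞) = ENNReal.ofReal 2 := by simp
  rw [e2] at hsum ⊢
  simp only [ENNReal.ofReal_rpow_of_nonneg NNReal.zero_le_coe hp',
    ENNReal.ofReal_rpow_of_nonneg NNReal.zero_le_coe hσ0.le,
    ENNReal.ofReal_rpow_of_nonneg NNReal.zero_le_coe hσ1] at *
  have pw : ∀ x : ℝ≥0, (((x : ℝ) ^ (1 / p)) ^ p) = x := fun x => by
    rw [← Real.rpow_mul x.coe_nonneg, one_div_mul_cancel hp0.ne', Real.rpow_one]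
  have pw2 : ∀ x : ℝ≥0, (((x : ℝ) ^ (1 / p)) ^ (p * σ)) = (x : ℝ) ^ σ := fun x => by
    rw [Real.rpow_mul (by positivity), pw]
  have pw3 : ∀ x : ℝ≥0, (((x : ℝ) ^ (1 / p)) ^ (p * σ - p)) = (x : ℝ) ^ (σ - 1) := fun x => by
    rw [show p * σ - p = p * (σ - 1) by ring, Real.rpow_mul (by positivity), pw]
  have mk : ∀ x y z : ℝ≥0, ENNReal.ofReal ((x : ℝ) ^ (1 / p)) ≤ ENNReal.ofReal ((y : ℝ) ^ (1 / p)) +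
      ENNReal.ofReal ((z : ℝ) ^ (1 / p)) → (x : ℝ) ^ (1 / p) ≤ (y : ℝ) ^ (1 / p) + (z : ℝ) ^ (1 / p) :=
    fun x y z hh => by
      rw [← ENNReal.ofReal_add (by positivity) (by positivity)] at hh
      exact (ENNReal.ofReal_le_ofReal_iff (by positivity)).1 hh
  have hsum' : (U : ℝ) + V ≤ 2 * W + C * w := by
    rw [← ENNReal.ofReal_add (by positivity) (by positivity), ← ENNReal.ofReal_mul (by norm_num),
      ← ENNReal.ofReal_mul hC, ← ENNReal.ofReal_add (by positivity) (by positivity)] at hsum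
    exact (ENNReal.ofReal_le_ofReal_iff (by positivity)).1 hsum
  have h1 := mk _ _ _ hUW
  have h2 := mk _ _ _ hWU
  have h3 := mk _ _ _ hVW
  have h4 := mk _ _ _ hWV
  -- The numbers `W, w, U, V` are `p`-th powers of norms, so the real inequality applies to their
  -- roots with `α = p` and `β = σ`.
  have key := h ((W : ℝ) ^ (1 / p)) ((w : ℝ) ^ (1 / p)) ((U : ℝ) ^ (1 / p)) ((V : ℝ) ^ (1 / p))
    (by positivity) (by positivity) (by positivity) (by positivity)
    (abs_le.2 ⟨by linarith, by linarith⟩) (abs_le.2 ⟨by linarith, by linarith⟩) ?_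
  · simp only [pw2, pw3, pw] at key
    have hCn : ((C'.toNNReal + 1 : ℝ≥0) : ℝ≥0∞) = ENNReal.ofReal (C' + 1) := by
      rw [ENNReal.ofReal_add hC' zero_le_one]; simp [ENNReal.ofReal]
    rw [hCn, ← ENNReal.ofReal_add (by positivity) (by positivity),
      ← ENNReal.ofReal_mul (by norm_num), ← ENNReal.ofReal_mul (by positivity),
      ← ENNReal.ofReal_add (by positivity) (by positivity),
      ← ENNReal.ofReal_mul (by positivity), ← ENNReal.ofReal_add (by positivity) (by positivity)]
    apply ENNReal.ofReal_le_ofReal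
    refine key.trans ?_
    have : (0 : ℝ) ≤ (W : ℝ) ^ (σ - 1) * w + (w : ℝ) ^ σ := by positivity
    linarith
  · intro hw0 hwW
    have hW0 := hw0.trans_le hwW
    rw [Real.div_rpow (by positivity) (by positivity)]
    simp only [pw]
    have : 0 < (W : ℝ) := by rw [← pw W]; positivity
    calc (U : ℝ) + V ≤ 2 * W + C * w := hsum'
      _ = _ := by field_simp

/-- The `p`-th power of a seminorm, with values in `[0, ∞]`. -/
noncomputable def Seminorm.epow {B : Type*} [NormedAddCommGroup B] [NormedSpace ℝ B]
    (nu : Seminorm ℝ B) (p : ℝ) (x : B) : ℝ≥0∞ := ENNReal.ofReal (nu x) ^ p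

section

variable {B : Type w} [NormedAddCommGroup B] [NormedSpace ℝ B] {nu : Seminorm ℝ B} {p : ℝ}

theorem Seminorm.epow_neg (x : B) : nu.epow p (-x) = nu.epow p x := by simp [Seminorm.epow]

theorem Seminorm.epow_zero (hp : 0 < p) : nu.epow p 0 = 0 := by simp [Seminorm.epow, hp]

theorem Seminorm.epow_two_point (hp : 0 < p) {C : ℝ} (hC : 0 ≤ C)
    (h : ∀ x y : B, nu (x + y) ^ p + nu (x - y) ^ p ≤ 2 * nu x ^ p + C * nu y ^ p) (x y : B) :
    nu.epow p (x + y) + nu.epow p (x - y) ≤ 2 * nu.epow p x + ENNReal.ofReal C * nu.epow p y := by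
  have e2 : (2 : ℝ≥0∞) = ENNReal.ofReal 2 := by simp
  have h0 : ∀ z : B, 0 ≤ nu z ^ p := fun z => Real.rpow_nonneg (apply_nonneg _ _) _
  simp only [Seminorm.epow, ENNReal.ofReal_rpow_of_nonneg (apply_nonneg nu _) hp.le, e2]
  rw [← ENNReal.ofReal_add (h0 _) (h0 _), ← ENNReal.ofReal_mul (by norm_num),
    ← ENNReal.ofReal_mul hC, ← ENNReal.ofReal_add (mul_nonneg (by norm_num) (h0 _))
      (mul_nonneg hC (h0 _))]
  exact ENNReal.ofReal_le_ofReal (h x y)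

/-- Minkowski's inequality; it provides the triangle inequalities required by
`exists_two_point_ennreal`. -/
theorem Seminorm.lintegral_epow_add_rpow_le [MeasurableSpace B] [BorelSpace B]
    (hnu : Continuous nu) (hp : 1 ≤ p) {Y : Type*} [MeasurableSpace Y] {ν : Measure Y} {f f' : Y → B}
    (hf : Measurable f) (hf' : Measurable f') :
    (∫⁻ y, nu.epow p (f y + f' y) ∂ν) ^ (1 / p) ≤
      (∫⁻ y, nu.epow p (f y) ∂ν) ^ (1 / p) + (∫⁻ y, nu.epow p (f' y) ∂ν) ^ (1 / p) := by
  have hm : ∀ {k : Y → B}, Measurable k → Measurable fun y => ENNReal.ofReal (nu (k y)) :=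
    fun hk => ENNReal.measurable_ofReal.comp (hnu.measurable.comp hk)
  refine le_trans ?_ (ENNReal.lintegral_Lp_add_le (hm hf).aemeasurable (hm hf').aemeasurable hp)
  have : 0 ≤ 1 / p := by positivity
  refine ENNReal.rpow_le_rpow (lintegral_mono fun y => ?_) this
  simp only [Seminorm.epow, Pi.add_apply]
  rw [← ENNReal.ofReal_add (apply_nonneg _ _) (apply_nonneg _ _)]
  exact ENNReal.rpow_le_rpow (ENNReal.ofReal_le_ofReal (map_add_le_add nu _ _)) (by linarith)

theorem Seminorm.measurable_epow [MeasurableSpace B] [BorelSpace B] (hnu : Continuous nu) :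
    Measurable (nu.epow p) :=
  (ENNReal.measurable_ofReal.comp hnu.measurable).pow_const _

/-- Jensen's inequality for a continuous seminorm. -/
theorem Seminorm.ofReal_integral_le [CompleteSpace B] (hnu : Continuous nu) {T : Type*}
    [MeasurableSpace T] {μ : Measure T} [IsProbabilityMeasure μ] {f : T → B} (hf : Integrable f μ) :
    ENNReal.ofReal (nu (∫ t, f t ∂μ)) ≤ ∫⁻ t, ENNReal.ofReal (nu (f t)) ∂μ := by
  by_cases hi : Integrable (fun t => nu (f t)) μ
  · have h := ConvexOn.map_integral_le nu.convexOn hnu.continuousOn isClosed_univ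
      (Filter.Eventually.of_forall fun _ => Set.mem_univ _) hf hi
    rw [← ofReal_integral_eq_lintegral_ofReal hi
      (Filter.Eventually.of_forall fun _ => apply_nonneg _ _)]
    exact ENNReal.ofReal_le_ofReal h
  · have : ∫⁻ t, ENNReal.ofReal (nu (f t)) ∂μ = ∞ := by
      by_contra hne
      refine hi ⟨hnu.comp_aestronglyMeasurable hf.1, ?_⟩
      rw [HasFiniteIntegral]
      convert lt_top_iff_ne_top.2 hne using 3 with t
      rw [Real.enorm_eq_ofReal (apply_nonneg _ _)]
    simp [this]

theorem Seminorm.epow_integral_le [CompleteSpace B] (hnu : Continuous nu) (hp : 1 ≤ p)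
    {T : Type*} [MeasurableSpace T] {μ : Measure T} [IsProbabilityMeasure μ] {f : T → B}
    (hf : Integrable f μ) :
    nu.epow p (∫ t, f t ∂μ) ≤ ∫⁻ t, nu.epow p (f t) ∂μ := by
  have h := Seminorm.ofReal_integral_le hnu hf
  refine (ENNReal.rpow_le_rpow h (by linarith)).trans ?_
  exact lintegral_rpow_le_lintegral_rpow
    (ENNReal.measurable_ofReal.comp_aemeasurable
      (hnu.comp_aestronglyMeasurable hf.1).aemeasurable) hp

/-- Adding a centered random function does not decrease the `L ^ p` norm on average. -/
theorem Seminorm.lintegral_epow_le [CompleteSpace B] [MeasurableSpace B] [BorelSpace B]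
    [SecondCountableTopology B] (hnu : Continuous nu) (hp : 1 ≤ p) {Y T : Type*}
    [MeasurableSpace Y] [MeasurableSpace T] {ν : Measure Y} [SFinite ν] {μ : Measure T}
    [IsProbabilityMeasure μ] {S : Y → B} {D : T → Y → B} (hS : Measurable S)
    (hD : Measurable (Function.uncurry D)) (hi : ∀ y, Integrable (fun t => D t y) μ)
    (h0 : ∀ y, ∫ t, D t y ∂μ = 0) :
    ∫⁻ y, nu.epow p (S y) ∂ν ≤ ∫⁻ t, ∫⁻ y, nu.epow p (S y + D t y) ∂ν ∂μ := by
  have m1 : Measurable (Function.uncurry fun t y => nu.epow p (S y + D t y)) :=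
    (Seminorm.measurable_epow hnu).comp ((hS.comp measurable_snd).add hD)
  rw [lintegral_lintegral_swap m1.aemeasurable]
  refine lintegral_mono fun y => ?_
  have hint : Integrable (fun t => S y + D t y) μ := (integrable_const _).add (hi y)
  have := Seminorm.epow_integral_le hnu hp hint
  rwa [integral_add (integrable_const _) (hi y), h0 y, integral_const, add_zero, probReal_univ,
    one_smul] at this

/-- One step of the moment inequality: adding a centered random function `D` to a fixed function
`S`, measured by powers of the `L ^ p` norm. -/
theorem Seminorm.exists_one_step [CompleteSpace B] [MeasurableSpace B] [BorelSpace B]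
    [SecondCountableTopology B] (hnu : Continuous nu) (hp1 : 1 < p) (hp2 : p ≤ 2) {C : ℝ}
    (hC : 0 ≤ C)
    (h : ∀ x y : B, nu (x + y) ^ p + nu (x - y) ^ p ≤ 2 * nu x ^ p + C * nu y ^ p)
    (σ : ℝ) (hσ : 1 ≤ σ) :
    ∃ C' : ℝ≥0, ∀ (Y T : Type v) [MeasurableSpace Y] [MeasurableSpace T] (ν : Measure Y)
      [SFinite ν] (μ : Measure T) [IsProbabilityMeasure μ] (S : Y → B) (D : T → Y → B),
      Measurable S → Measurable (Function.uncurry D) → (∀ y, Integrable (fun t => D t y) μ) →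
      (∀ y, ∫ t, D t y ∂μ = 0) →
      ∫⁻ t, (∫⁻ y, nu.epow p (S y + D t y) ∂ν) ^ σ ∂μ ≤
        (∫⁻ y, nu.epow p (S y) ∂ν) ^ σ +
        C' * ((∫⁻ y, nu.epow p (S y) ∂ν) ^ (σ - 1) * ∫⁻ t, ∫⁻ y, nu.epow p (D t y) ∂ν ∂μ +
          ∫⁻ t, (∫⁻ y, nu.epow p (D t y) ∂ν) ^ σ ∂μ) := by
  obtain ⟨C', hC'⟩ := exists_two_point_ennreal p σ C hp1 hp2 hσ hC
  have hp0 : 0 < p := by linarith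
  refine ⟨C', fun Y T _ _ ν _ μ _ S D hS hD hi h0 => ?_⟩
  have hg : Measurable (nu.epow p) := Seminorm.measurable_epow hnu
  have hDt : ∀ t, Measurable (D t) := fun t => hD.of_uncurry_left
  set W := ∫⁻ y, nu.epow p (S y) ∂ν with hW
  have hmD : Measurable fun t => ∫⁻ y, nu.epow p (D t y) ∂ν :=
    (hg.comp hD).lintegral_prod_right'
  have hmadd : Measurable fun z : T × Y => S z.2 + D z.1 z.2 := (hS.comp measurable_snd).add hD
  have hmsub : Measurable fun z : T × Y => S z.2 - D z.1 z.2 := (hS.comp measurable_snd).sub hD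
  have hmU : Measurable fun t => ∫⁻ y, nu.epow p (S y + D t y) ∂ν :=
    (hg.comp hmadd).lintegral_prod_right'
  have hmV : Measurable fun t => ∫⁻ y, nu.epow p (S y - D t y) ∂ν :=
    (hg.comp hmsub).lintegral_prod_right'
  by_cases hWt : W = ∞
  · simp [hWt, ENNReal.top_rpow_of_pos (by linarith : 0 < σ)]
  have pt : ∀ t, (∫⁻ y, nu.epow p (S y + D t y) ∂ν) ^ σ + (∫⁻ y, nu.epow p (S y - D t y) ∂ν) ^ σ
      ≤ 2 * W ^ σ + C' * (W ^ (σ - 1) * ∫⁻ y, nu.epow p (D t y) ∂ν +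
        (∫⁻ y, nu.epow p (D t y) ∂ν) ^ σ) := by
    intro t
    have hneg : ∫⁻ y, nu.epow p (-D t y) ∂ν = ∫⁻ y, nu.epow p (D t y) ∂ν := by
      simp only [Seminorm.epow_neg]
    apply hC'
    · exact Seminorm.lintegral_epow_add_rpow_le hnu hp1.le hS (hDt t)
    · have := Seminorm.lintegral_epow_add_rpow_le (ν := ν) hnu hp1.le (hS.add (hDt t)) (hDt t).neg
      simpa [hneg] using this
    · have := Seminorm.lintegral_epow_add_rpow_le (ν := ν) hnu hp1.le hS (hDt t).neg
      simpa [hneg, sub_eq_add_neg] using this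
    · have := Seminorm.lintegral_epow_add_rpow_le (ν := ν) hnu hp1.le (hS.sub (hDt t)) (hDt t)
      simpa using this
    · have m1 : Measurable fun y => nu.epow p (S y + D t y) := hg.comp (hS.add (hDt t))
      have m2 : Measurable fun y => nu.epow p (S y) := hg.comp hS
      have m3 : Measurable fun y => nu.epow p (D t y) := hg.comp (hDt t)
      rw [← lintegral_add_left m1, hW, ← lintegral_const_mul _ m2, ← lintegral_const_mul _ m3,
        ← lintegral_add_left (m2.const_mul _)]
      exact lintegral_mono fun y => Seminorm.epow_two_point hp0 hC h _ _
  -- Since `-D` is centered too, the average of the term with `S - D` is at least `W ^ σ`. This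
  -- cancels one of the two copies of `W ^ σ` in the averaged two-point inequality.
  have jen : W ^ σ ≤ ∫⁻ t, (∫⁻ y, nu.epow p (S y - D t y) ∂ν) ^ σ ∂μ := by
    refine le_trans ?_ (lintegral_rpow_le_lintegral_rpow hmV.aemeasurable hσ)
    refine ENNReal.rpow_le_rpow ?_ (by linarith)
    simpa only [sub_eq_add_neg, Pi.neg_apply] using Seminorm.lintegral_epow_le (D := -D) hnu hp1.le
      hS hD.neg (fun y => (hi y).neg) fun y => by simp [integral_neg, h0 y]
  have hfin : W ^ σ ≠ ∞ := ENNReal.rpow_ne_top_of_nonneg (by linarith) hWt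
  have tot := lintegral_mono (μ := μ) pt
  have m1 : Measurable fun t => W ^ (σ - 1) * ∫⁻ y, nu.epow p (D t y) ∂ν +
      (∫⁻ y, nu.epow p (D t y) ∂ν) ^ σ := (hmD.const_mul _).add (hmD.pow_const _)
  rw [lintegral_add_left (hmU.pow_const _), lintegral_add_left measurable_const,
    lintegral_const, measure_univ, mul_one,
    lintegral_const_mul _ m1,
    lintegral_add_left (hmD.const_mul _), lintegral_const_mul _ hmD, two_mul] at tot
  have t2 := (add_le_add_right jen _).trans tot
  rw [add_assoc, add_comm] at t2
  exact ENNReal.le_of_add_le_add_left hfin t2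

end

/-! ### Resampling of coordinates and Doob's inequality -/

/-- Resampling one coordinate preserves a product measure. -/
theorem measurePreserving_update_infinitePi {ι S : Type*} [DecidableEq ι] [MeasurableSpace S]
    (μ : Measure S) [IsProbabilityMeasure μ] (i : ι) :
    MeasurePreserving (fun z : (ι → S) × S => Function.update z.1 i z.2)
      ((Measure.infinitePi fun _ : ι => μ).prod μ) (Measure.infinitePi fun _ : ι => μ) := by
  have hm : Measurable (fun z : (ι → S) × S => Function.update z.1 i z.2) := by
    refine measurable_pi_iff.2 fun j => ?_
    by_cases hj : j = i
    · subst hj; simpa using measurable_snd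
    · simp only [Function.update_of_ne hj]
      exact (measurable_pi_apply j).comp measurable_fst
  refine ⟨hm, Measure.eq_infinitePi _ fun s t ht => ?_⟩
  rw [Measure.map_apply hm (.pi s.countable_toSet fun j _ => ht j)]
  by_cases hi : i ∈ s
  · have : (fun z : (ι → S) × S => Function.update z.1 i z.2) ⁻¹' (Set.pi s t) =
        (Set.pi (s.erase i : Finset ι) t) ×ˢ t i := by
      ext z
      simp only [Set.mem_preimage, Set.mem_pi, Set.mem_prod, Finset.coe_erase, Set.mem_sdiff,
        Set.mem_singleton_iff, Finset.mem_coe]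
      constructor
      · refine fun h => ⟨fun j hj => ?_, by simpa using h i hi⟩
        simpa [hj.2] using h j hj.1
      · rintro ⟨h1, h2⟩ j hj
        by_cases hji : j = i
        · subst hji; simpa using h2
        · simpa [hji] using h1 j ⟨hj, hji⟩
    rw [this, Measure.prod_prod, Measure.infinitePi_pi _ (fun j _ => ht j),
      Finset.prod_erase_mul _ _ hi]
  · have : (fun z : (ι → S) × S => Function.update z.1 i z.2) ⁻¹' (Set.pi s t) =
        (Set.pi s t) ×ˢ Set.univ := by
      ext z
      simp only [Set.mem_preimage, Set.mem_pi, Set.mem_prod, Finset.mem_coe, Set.mem_univ, and_true]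
      refine forall₂_congr fun j hj => ?_
      rw [Function.update_of_ne (by rintro rfl; exact hi hj)]
    rw [this, Measure.prod_prod, Measure.infinitePi_pi _ (fun j _ => ht j), measure_univ, mul_one]

/-- Fubini for one coordinate. It plays the role of conditioning on the past when the integrand
depends on the coordinates up to `i` only. -/
theorem lintegral_infinitePi_update {ι S : Type*} [DecidableEq ι] [MeasurableSpace S]
    (μ : Measure S) [IsProbabilityMeasure μ] (i : ι) {F : (ι → S) → ℝ≥0∞} (hF : Measurable F) :
    ∫⁻ x, F x ∂(Measure.infinitePi fun _ : ι => μ) =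
      ∫⁻ x, ∫⁻ t, F (Function.update x i t) ∂μ ∂(Measure.infinitePi fun _ : ι => μ) := by
  have h := measurePreserving_update_infinitePi (ι := ι) μ i
  rw [← h.lintegral_comp hF]
  exact lintegral_prod _ (hF.comp h.measurable).aemeasurable

/-- A form of Young's inequality. -/
theorem exists_rpow_mul_le (α β : ℝ) (hα : 0 ≤ α) (hβ : 0 < β) (ε : ℝ≥0) (hε : 0 < ε) :
    ∃ C : ℝ≥0, ∀ a b : ℝ≥0∞, a ^ α * b ^ β ≤ ε * a ^ (α + β) + C * b ^ (α + β) := by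
  -- For `b ≤ δ * a` the product is at most `δ ^ β * a ^ (α + β)`, and `δ ^ β = ε`; otherwise `a ≤
  -- δ⁻¹ * b`.
  set δ : ℝ≥0 := ε ^ (1 / β) with hδ
  have hδ0 : 0 < δ := NNReal.rpow_pos hε
  refine ⟨(δ⁻¹) ^ α, fun a b => ?_⟩
  rcases le_total b (δ * a) with h | h
  · refine le_add_right ?_
    calc a ^ α * b ^ β ≤ a ^ α * (δ * a) ^ β := by gcongr
      _ = ε * a ^ (α + β) := by
        rw [ENNReal.mul_rpow_of_nonneg _ _ hβ.le, ENNReal.rpow_add_of_nonneg _ _ hα hβ.le, hδ,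
          ← ENNReal.coe_rpow_of_nonneg _ hβ.le, ← NNReal.rpow_mul, one_div_mul_cancel hβ.ne',
          NNReal.rpow_one]
        ring
  · refine le_add_left ?_
    have h' : a ≤ (δ⁻¹ : ℝ≥0) * b := by
      calc a = (δ⁻¹ : ℝ≥0) * (δ * a) := by
            rw [← mul_assoc, ← ENNReal.coe_mul, inv_mul_cancel₀ hδ0.ne', ENNReal.coe_one, one_mul]
        _ ≤ _ := by gcongr
    calc a ^ α * b ^ β ≤ ((δ⁻¹ : ℝ≥0) * b) ^ α * b ^ β := by gcongr
      _ = _ := by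
        rw [ENNReal.mul_rpow_of_nonneg _ _ hα, ENNReal.rpow_add_of_nonneg _ _ hα hβ.le,
          ENNReal.coe_rpow_of_nonneg _ hα, mul_assoc]

/-- The pointwise inequality behind Doob's `L ^ σ` inequality. -/
theorem doob_pointwise (σ : ℝ) (hσ : 1 < σ) (M x : ℝ≥0) :
    (σ - 1).toNNReal * (max M x) ^ σ + σ.toNNReal * (M ^ (σ - 1) * x) ≤
      (σ - 1).toNNReal * M ^ σ + σ.toNNReal * ((max M x) ^ (σ - 1) * x) := by
  rcases le_total x M with h | h
  · rw [max_eq_left h]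
  · rw [max_eq_right h]
    have e : ∀ y : ℝ≥0, y ^ (σ - 1) * y = y ^ σ := fun y => by
      rw [← NNReal.rpow_add_one' (by linarith : σ - 1 + 1 ≠ 0)]; ring_nf
    have hσ1 : σ.toNNReal = (σ - 1).toNNReal + 1 := by
      rw [← Real.toNNReal_one, ← Real.toNNReal_add (by linarith) zero_le_one]; ring_nf
    rw [e x]
    rcases eq_or_ne x 0 with hx | hx
    · subst hx
      have : M = 0 := le_antisymm h zero_le
      simp [this]
    rw [← NNReal.coe_le_coe]
    push_cast
    rw [Real.coe_toNNReal _ (by linarith), Real.coe_toNNReal _ (by linarith)]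
    have hx0 : (0 : ℝ) < x := by positivity
    have hMx : (M : ℝ) ≤ x := h
    rcases eq_or_ne M 0 with hM | hM
    · subst hM
      simp only [NNReal.coe_zero]
      rw [Real.zero_rpow (by linarith), Real.zero_rpow (by linarith)]
      have : (0 : ℝ) ≤ x ^ σ := by positivity
      linarith
    have hM0 : (0 : ℝ) < M := by positivity
    -- The power `σ` lies above its tangent at `M`: `x ^ σ ≥ M ^ (σ - 1) * (σ * x - (σ - 1) * M)`.
    have hb := one_add_mul_self_le_rpow_one_add (s := (x : ℝ) / M - 1)
      (by have : (0 : ℝ) ≤ x / M := by positivity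
          linarith) hσ.le
    have e2 : 1 + ((x : ℝ) / M - 1) = x / M := by ring
    rw [e2, Real.div_rpow hx0.le hM0.le, le_div_iff₀ (by positivity)] at hb
    have e3 : (M : ℝ) ^ σ = M ^ (σ - 1) * M := by
      rw [← Real.rpow_add_one hM0.ne']; ring_nf
    have e4 : (1 + σ * ((x : ℝ) / M - 1)) * M ^ σ = M ^ (σ - 1) * (σ * x - (σ - 1) * M) := by
      rw [e3]; field_simp; ring
    rw [e4] at hb
    rw [e3]
    nlinarith

theorem doob_pointwise_ennreal (σ : ℝ) (hσ : 1 < σ) (M x : ℝ≥0∞) :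
    ((σ - 1).toNNReal : ℝ≥0∞) * (max M x) ^ σ + (σ.toNNReal : ℝ≥0∞) * (M ^ (σ - 1) * x) ≤
      (σ - 1).toNNReal * M ^ σ + σ.toNNReal * ((max M x) ^ (σ - 1) * x) := by
  have hσ1 : ((σ - 1).toNNReal : ℝ≥0∞) ≠ 0 := by simpa using hσ
  have hσ2 : (σ.toNNReal : ℝ≥0∞) ≠ 0 := by simp; linarith
  have h1 : 0 < σ := by linarith
  have h2 : 0 < σ - 1 := by linarith
  rcases eq_or_ne M ∞ with rfl | hM
  · rw [ENNReal.top_rpow_of_pos h1, ENNReal.mul_top hσ1, top_add]; exact le_top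
  rcases eq_or_ne x ∞ with rfl | hx
  · rw [max_eq_right le_top, ENNReal.top_rpow_of_pos h2, ENNReal.top_mul_top, ENNReal.mul_top hσ2,
      add_top]
    exact le_top
  lift M to ℝ≥0 using hM
  lift x to ℝ≥0 using hx
  have := doob_pointwise σ hσ M x
  rw [← ENNReal.coe_max]
  simp only [← ENNReal.coe_rpow_of_nonneg _ h1.le, ← ENNReal.coe_rpow_of_nonneg _ h2.le]
  exact_mod_cast this

/-- **Doob's maximal inequality** for a nonnegative process on a product space: if averaging
`X (n + 1)` over the `n`-th coordinate dominates `X n` and `X n` depends only on the first `n`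
coordinates, then `E (max X) ^ σ ≤ K E (X n) ^ σ`. -/
theorem exists_doob (σ : ℝ) (hσ : 1 < σ) : ∃ K : ℝ≥0, ∀ (S : Type v) [MeasurableSpace S]
    (μ : Measure S) [IsProbabilityMeasure μ] (X : ℕ → (ℕ → S) → ℝ≥0∞),
    (∀ n, Measurable (X n)) →
    (∀ n x k t, n ≤ k → X n (Function.update x k t) = X n x) →
    (∀ n x, X n x ≤ ∫⁻ t, X (n + 1) (Function.update x n t) ∂μ) → ∀ n : ℕ,
      ∫⁻ x, ((Finset.range (n + 1)).sup fun k => X k x) ^ σ ∂(Measure.infinitePi fun _ : ℕ => μ) ≤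
        K * ∫⁻ x, X n x ^ σ ∂(Measure.infinitePi fun _ : ℕ => μ) := by
  have hσ0 : 0 < σ := by linarith
  have hσ1 : 0 < (σ - 1).toNNReal := by simpa using hσ
  have hσ2 : 0 < σ.toNNReal := by simpa using hσ0
  have hpt := doob_pointwise_ennreal σ hσ
  have hcd : (σ - 1).toNNReal ≤ σ.toNNReal := Real.toNNReal_mono (by linarith)
  set c : ℝ≥0 := (σ - 1).toNNReal with hc
  set d : ℝ≥0 := σ.toNNReal with hd
  -- With this parameter, Young's inequality in `c * E M ^ σ ≤ d * E (M ^ (σ - 1) * X)` produces `(c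
  -- / 2) * E M ^ σ` on the right, which can be absorbed.
  obtain ⟨C, hC⟩ := exists_rpow_mul_le (σ - 1) 1 (by linarith) one_pos (c / (2 * d)) (by positivity)
  simp only [ENNReal.rpow_one, sub_add_cancel] at hC
  refine ⟨2 * d * C / c + 1, fun S _ μ _ X hX hdep hsub n => ?_⟩
  set P := Measure.infinitePi fun _ : ℕ => μ with hP
  set M : ℕ → (ℕ → S) → ℝ≥0∞ := fun n x => (Finset.range (n + 1)).sup fun k => X k x with hM
  have hMS : ∀ n x, M (n + 1) x = max (M n x) (X (n + 1) x) := fun n x => by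
    simp only [hM]
    rw [Finset.range_add_one (n := n + 1), Finset.sup_insert, sup_comm]
  have hM0 : ∀ x, M 0 x = X 0 x := fun x => by simp [hM]
  have hMm : ∀ n, Measurable (M n) := fun n => by
    induction n with
    | zero => simpa only [funext hM0] using hX 0
    | succ n ih => simpa only [funext (hMS n)] using ih.max (hX (n + 1))
  have hMdep : ∀ n x k t, n ≤ k → M n (Function.update x k t) = M n x := fun n x k t hk => by
    refine Finset.sup_congr rfl fun j hj => hdep j x k t ?_
    have := Finset.mem_range.1 hj
    omega
  have hm1 : ∀ n x, Measurable fun t => X (n + 1) (Function.update x n t) := fun n x =>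
    (hX (n + 1)).comp (measurable_update x)
  have hmB : ∀ n k, Measurable fun x => M n x ^ (σ - 1) * X k x := fun n k =>
    ((hMm n).pow_const _).mul (hX k)
  have hmA : ∀ n, Measurable fun x => M n x ^ σ := fun n => (hMm n).pow_const _
  have hmX : ∀ n, Measurable fun x => X n x ^ σ := fun n => (hX n).pow_const _
  have hinc : ∀ n, ∫⁻ x, M n x ^ (σ - 1) * X n x ∂P ≤ ∫⁻ x, M n x ^ (σ - 1) * X (n + 1) x ∂P := by
    intro n
    rw [hP, lintegral_infinitePi_update μ n (hmB n (n + 1))]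
    refine lintegral_mono fun x => ?_
    simp only [hMdep n x n _ le_rfl]
    rw [lintegral_const_mul _ (hm1 n x)]
    gcongr
    exact hsub n x
  have hXmono : Monotone fun n => ∫⁻ x, X n x ^ σ ∂P := by
    refine monotone_nat_of_le_succ fun n => ?_
    rw [hP, lintegral_infinitePi_update μ n (hmX (n + 1))]
    refine lintegral_mono fun x => ?_
    refine le_trans ?_ (lintegral_rpow_le_lintegral_rpow (hm1 n x).aemeasurable hσ.le)
    exact ENNReal.rpow_le_rpow (hsub n x) hσ0.le
  by_cases hfin : ∫⁻ x, X n x ^ σ ∂P = ∞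
  · rw [hfin, ENNReal.mul_top (by simp)]
    exact le_top
  have hXfin : ∀ k ≤ n, ∫⁻ x, X k x ^ σ ∂P ≠ ∞ := fun k hk => ne_top_of_le_ne_top hfin (hXmono hk)
  have hAfin : ∀ k ≤ n, ∫⁻ x, M k x ^ σ ∂P ≠ ∞ := by
    intro k hk
    induction k with
    | zero => simpa only [hM0] using hXfin 0 hk
    | succ k ih =>
      refine ne_top_of_le_ne_top (ENNReal.add_ne_top.2 ⟨ih (by omega), hXfin (k + 1) hk⟩) ?_
      rw [← lintegral_add_left (hmA k)]
      refine lintegral_mono fun x => ?_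
      simp only [hMS]
      rcases max_choice (M k x) (X (k + 1) x) with h | h <;> rw [h]
      · exact le_self_add
      · exact le_add_self
  -- Induction on `k` by the integrated pointwise inequality: `hinc` makes the term `d * E (M_k ^ (σ
  -- - 1) * X_{k+1})` appear on both sides. It is cancelled, which requires it to be finite
  -- (`hmid`).
  have main : ∀ k ≤ n, c * ∫⁻ x, M k x ^ σ ∂P ≤ d * ∫⁻ x, M k x ^ (σ - 1) * X k x ∂P := by
    intro k hk
    induction k with
    | zero =>
      gcongr with x
      rw [hM0]
      nth_rw 3 [← ENNReal.rpow_one (X 0 x)]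
      rw [← ENNReal.rpow_add_of_nonneg _ _ (by linarith) zero_le_one, sub_add_cancel]
    | succ k ih =>
      have hmid : ∫⁻ x, M k x ^ (σ - 1) * X (k + 1) x ∂P ≠ ∞ := by
        have h1 : ∫⁻ x, ((c / (2 * d) : ℝ≥0) * M k x ^ σ + C * X (k + 1) x ^ σ) ∂P ≠ ∞ := by
          rw [lintegral_add_left ((hmA k).const_mul _), lintegral_const_mul _ (hmA k),
            lintegral_const_mul _ (hmX (k + 1))]
          exact ENNReal.add_ne_top.2 ⟨ENNReal.mul_ne_top ENNReal.coe_ne_top (hAfin k (by omega)),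
            ENNReal.mul_ne_top ENNReal.coe_ne_top (hXfin (k + 1) hk)⟩
        exact ne_top_of_le_ne_top h1 (lintegral_mono fun x => hC _ _)
      have h2 := lintegral_mono (μ := P) fun x => hpt (M k x) (X (k + 1) x)
      simp only [← hMS] at h2
      rw [lintegral_add_left ((hmA (k + 1)).const_mul _), lintegral_const_mul _ (hmA (k + 1)),
        lintegral_const_mul _ (hmB k (k + 1)), lintegral_add_left ((hmA k).const_mul _),
        lintegral_const_mul _ (hmA k), lintegral_const_mul _ (hmB (k + 1) (k + 1))] at h2
      have h3 : (c : ℝ≥0∞) * ∫⁻ x, M k x ^ σ ∂P ≤ d * ∫⁻ x, M k x ^ (σ - 1) * X (k + 1) x ∂P :=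
        (ih (by omega)).trans (mul_le_mul_right (hinc k) _)
      have h4 := h2.trans (add_le_add_left h3 _)
      rw [add_comm] at h4
      exact ENNReal.le_of_add_le_add_left (ENNReal.mul_ne_top ENNReal.coe_ne_top hmid) h4
  have fin := (main n le_rfl).trans (mul_le_mul_right (lintegral_mono fun x =>
    hC (M n x) (X n x)) _)
  rw [lintegral_add_left ((hmA n).const_mul _), lintegral_const_mul _ (hmA n),
    lintegral_const_mul _ (hmX n)] at fin
  have hA := hAfin n le_rfl
  have hX' := hXfin n le_rfl
  change ∫⁻ x, M n x ^ σ ∂P ≤ _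
  lift ∫⁻ x, M n x ^ σ ∂P to ℝ≥0 using hA with A
  lift ∫⁻ x, X n x ^ σ ∂P to ℝ≥0 using hX' with D
  norm_cast at fin ⊢
  have e1 : d * (c / (2 * d) * A + C * D) = c / 2 * A + d * C * D := by
    field_simp
  rw [e1] at fin
  have fin' : (c : ℝ) * A ≤ c / 2 * A + d * C * D := by exact_mod_cast fin
  have e2 : (A : ℝ) ≤ 2 * d * C / c * D := by
    have hc0 : (0 : ℝ) < c := hσ1
    rw [div_mul_eq_mul_div, le_div_iff₀ hc0]
    linarith
  have e3 : (A : ℝ) ≤ (2 * d * C / c + 1) * D := by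
    have : (0 : ℝ) ≤ D := D.2
    linarith
  exact_mod_cast e3

/-! ### Rosenthal's inequality for smooth martingales -/

/-- **Rosenthal's inequality** for martingales with values in `L ^ p (ν; B)`, where the `p`-th power
of the seminorm `nu` of `B` satisfies a two-point smoothness inequality. The martingale is given
on a product space by its differences `D k x (x k)`, where `D k x` depends on the first `k`
coordinates of `x` only and is centered with respect to the law of the `k`-th coordinate. -/
theorem Seminorm.exists_rosenthal {B : Type w} [NormedAddCommGroup B] [NormedSpace ℝ B]
    {nu : Seminorm ℝ B} {p : ℝ} [CompleteSpace B] [MeasurableSpace B] [BorelSpace B]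
    [SecondCountableTopology B] (hnu : Continuous nu) (hp1 : 1 < p) (hp2 : p ≤ 2) {C : ℝ}
    (hC : 0 ≤ C)
    (h : ∀ x y : B, nu (x + y) ^ p + nu (x - y) ^ p ≤ 2 * nu x ^ p + C * nu y ^ p)
    (σ : ℝ) (hσ : 1 ≤ σ) :
    ∃ K : ℝ≥0, ∀ (Y S : Type v) [MeasurableSpace Y] [MeasurableSpace S] (ν : Measure Y)
      [SFinite ν] (μ : Measure S) [IsProbabilityMeasure μ] (D : ℕ → (ℕ → S) → S → Y → B),
      (∀ k, Measurable fun z : (ℕ → S) × S × Y => D k z.1 z.2.1 z.2.2) →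
      (∀ k x i t s y, k ≤ i → D k (Function.update x i t) s y = D k x s y) →
      (∀ k x y, Integrable (fun t => D k x t y) μ) →
      (∀ k x y, ∫ t, D k x t y ∂μ = 0) → ∀ n : ℕ,
      ∫⁻ x, (∫⁻ y, nu.epow p (∑ k ∈ Finset.range n, D k x (x k) y) ∂ν) ^ σ
          ∂(Measure.infinitePi fun _ : ℕ => μ) ≤
        K * (∑ k ∈ Finset.range n, ∫⁻ x, ∫⁻ t, (∫⁻ y, nu.epow p (D k x t y) ∂ν) ^ σ ∂μ
            ∂(Measure.infinitePi fun _ : ℕ => μ) +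
          ∫⁻ x, (∑ k ∈ Finset.range n, ∫⁻ t, ∫⁻ y, nu.epow p (D k x t y) ∂ν ∂μ) ^ σ
            ∂(Measure.infinitePi fun _ : ℕ => μ)) := by
  obtain ⟨C₁, hC₁⟩ := Seminorm.exists_one_step hnu hp1 hp2 hC h σ hσ
  have hp0 : 0 < p := by linarith
  have hσ0 : 0 < σ := by linarith
  have hg : Measurable (nu.epow p) := Seminorm.measurable_epow hnu
  -- the recursive bound for the moments, before the predictable terms are estimated
  have base : ∀ (Y S : Type v) [MeasurableSpace Y] [MeasurableSpace S] (ν : Measure Y)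
      [SFinite ν] (μ : Measure S) [IsProbabilityMeasure μ] (D : ℕ → (ℕ → S) → S → Y → B),
      (∀ k, Measurable fun z : (ℕ → S) × S × Y => D k z.1 z.2.1 z.2.2) →
      (∀ k x i t s y, k ≤ i → D k (Function.update x i t) s y = D k x s y) →
      (∀ k x y, Integrable (fun t => D k x t y) μ) →
      (∀ k x y, ∫ t, D k x t y ∂μ = 0) →
      ∃ (W V Q : ℕ → (ℕ → S) → ℝ≥0∞),
        (W = fun n x => ∫⁻ y, nu.epow p (∑ k ∈ Finset.range n, D k x (x k) y) ∂ν) ∧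
        (V = fun k x => ∫⁻ t, ∫⁻ y, nu.epow p (D k x t y) ∂ν ∂μ) ∧
        (Q = fun k x => ∫⁻ t, (∫⁻ y, nu.epow p (D k x t y) ∂ν) ^ σ ∂μ) ∧
        (∀ n, Measurable (W n)) ∧ (∀ n, Measurable (V n)) ∧ (∀ n, Measurable (Q n)) ∧
        (∀ x, W 0 x = 0) ∧
        (∀ n x k t, n ≤ k → W n (Function.update x k t) = W n x) ∧
        (∀ n x, W n x ≤ ∫⁻ t, W (n + 1) (Function.update x n t) ∂μ) ∧
        (∀ n, ∫⁻ x, W (n + 1) x ^ σ ∂(Measure.infinitePi fun _ : ℕ => μ) ≤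
          ∫⁻ x, W n x ^ σ ∂(Measure.infinitePi fun _ : ℕ => μ) +
          C₁ * (∫⁻ x, W n x ^ (σ - 1) * V n x ∂(Measure.infinitePi fun _ : ℕ => μ) +
            ∫⁻ x, Q n x ∂(Measure.infinitePi fun _ : ℕ => μ))) := by
    intro Y S _ _ ν _ μ _ D hD hdep hi h0
    have hSm : ∀ n, Measurable fun z : (ℕ → S) × Y =>
        ∑ k ∈ Finset.range n, D k z.1 (z.1 k) z.2 := fun n =>
      Finset.measurable_sum _ fun k _ => (hD k).comp (measurable_fst.prodMk
        (((measurable_pi_apply k).comp measurable_fst).prodMk measurable_snd))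
    have hw : ∀ k, Measurable fun z : (ℕ → S) × S => ∫⁻ y, nu.epow p (D k z.1 z.2 y) ∂ν := fun k =>
      Measurable.lintegral_prod_right' (f := fun z : ((ℕ → S) × S) × Y =>
        nu.epow p (D k z.1.1 z.1.2 z.2))
        (hg.comp ((hD k).comp (((measurable_fst.comp measurable_fst).prodMk
          ((measurable_snd.comp measurable_fst).prodMk measurable_snd)))))
    have hWm : ∀ n, Measurable fun x : ℕ → S =>
        ∫⁻ y, nu.epow p (∑ k ∈ Finset.range n, D k x (x k) y) ∂ν := fun n =>
      (hg.comp (hSm n)).lintegral_prod_right'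
    have hup : ∀ n x t y, ∑ k ∈ Finset.range (n + 1),
        D k (Function.update x n t) (Function.update x n t k) y =
        ∑ k ∈ Finset.range n, D k x (x k) y + D n x t y := fun n x t y => by
      rw [Finset.sum_range_succ, hdep n x n t _ y le_rfl, Function.update_self]
      congr 1
      refine Finset.sum_congr rfl fun k hk => ?_
      have := Finset.mem_range.1 hk
      rw [hdep k x n t _ y this.le, Function.update_of_ne this.ne]
    have hDx : ∀ n x, Measurable (Function.uncurry (D n x)) := fun n x =>
      (hD n).comp (measurable_const.prodMk measurable_id)
    have hVm : ∀ n, Measurable fun x => ∫⁻ t, ∫⁻ y, nu.epow p (D n x t y) ∂ν ∂μ := fun n =>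
      (hw n).lintegral_prod_right'
    have hQm : ∀ n, Measurable fun x => ∫⁻ t, (∫⁻ y, nu.epow p (D n x t y) ∂ν) ^ σ ∂μ := fun n =>
      ((hw n).pow_const σ).lintegral_prod_right'
    refine ⟨_, _, _, rfl, rfl, rfl, hWm, hVm, hQm, ?_, ?_, ?_, ?_⟩
    · intro x
      simp [Seminorm.epow_zero hp0]
    · intro n x i t hi
      refine lintegral_congr fun y => ?_
      congr 1
      refine Finset.sum_congr rfl fun k hk => ?_
      have := Finset.mem_range.1 hk
      rw [hdep k x i t _ y (by omega), Function.update_of_ne (by omega)]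
    · intro n x
      simp only [hup]
      exact Seminorm.lintegral_epow_le hnu hp1.le ((hSm n).comp measurable_prodMk_left) (hDx n x)
        (hi n x) (h0 n x)
    · intro n
      rw [lintegral_infinitePi_update μ n ((hWm (n + 1)).pow_const σ)]
      simp only [hup]
      have m1 : Measurable fun x : ℕ → S =>
          (∫⁻ y, nu.epow p (∑ k ∈ Finset.range n, D k x (x k) y) ∂ν) ^ (σ - 1) *
            ∫⁻ t, ∫⁻ y, nu.epow p (D n x t y) ∂ν ∂μ := ((hWm n).pow_const _).mul (hVm n)
      rw [← lintegral_add_left m1, ← lintegral_const_mul' _ _ ENNReal.coe_ne_top,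
        ← lintegral_add_left ((hWm n).pow_const _)]
      exact lintegral_mono fun x => hC₁ Y S ν μ _ (D n x)
        ((hSm n).comp measurable_prodMk_left) (hDx n x) (hi n x) (h0 n x)
  rcases hσ.eq_or_lt with rfl | hσ1
  -- For `σ = 1` the factor `W ^ (σ - 1)` is `1`, and summing the recursion suffices.
  · refine ⟨C₁, fun Y S _ _ ν _ μ _ D hD hdep hi h0 n => ?_⟩
    obtain ⟨W, V, Q, hW, hV, hQ, hWm, hVm, hQm, hW0, -, -, hrec⟩ := base Y S ν μ D hD hdep hi h0
    simp only [sub_self, ENNReal.rpow_zero, one_mul, ENNReal.rpow_one] at hrec ⊢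
    have : ∀ n, ∫⁻ x, W n x ∂(Measure.infinitePi fun _ : ℕ => μ) ≤
        C₁ * (∑ k ∈ Finset.range n, ∫⁻ x, Q k x ∂(Measure.infinitePi fun _ : ℕ => μ) +
          ∑ k ∈ Finset.range n, ∫⁻ x, V k x ∂(Measure.infinitePi fun _ : ℕ => μ)) := by
      intro n
      induction n with
      | zero => simp [hW0]
      | succ n ih =>
        refine (hrec n).trans ((add_le_add_left ih _).trans (le_of_eq ?_))
        rw [Finset.sum_range_succ, Finset.sum_range_succ]
        ring
    have := this n
    rw [← lintegral_finsetSum _ fun k _ => hVm k] at this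
    simpa only [hW, hV, hQ, ENNReal.rpow_one] using this
  · obtain ⟨K₁, hK₁⟩ := exists_doob.{v} σ hσ1
    -- The Young parameter offsets the factor `C₁` of the recursion and the Doob constant `K₁`:
    -- their product with it is at most `1 / 2`.
    obtain ⟨C₂, hC₂⟩ := exists_rpow_mul_le (σ - 1) 1 (by linarith) one_pos
      (1 / (2 * (C₁ + 1) * (K₁ + 1))) (by positivity)
    simp only [ENNReal.rpow_one, sub_add_cancel] at hC₂
    refine ⟨2 * C₁ * (C₂ + 1) + 1, fun Y S _ _ ν _ μ _ D hD hdep hi h0 n => ?_⟩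
    obtain ⟨W, V, Q, hW, hV, hQ, hWm, hVm, hQm, hW0, hWd, hWs, hrec⟩ := base Y S ν μ D hD hdep hi h0
    set P := Measure.infinitePi fun _ : ℕ => μ with hP
    have hdoob := hK₁ S μ W hWm hWd hWs n
    suffices H : ∫⁻ x, W n x ^ σ ∂P ≤ (2 * C₁ * (C₂ + 1) + 1 : ℝ≥0) *
        (∑ k ∈ Finset.range n, ∫⁻ x, Q k x ∂P +
          ∫⁻ x, (∑ k ∈ Finset.range n, V k x) ^ σ ∂P) by
      simpa only [hW, hV, hQ] using H
    set R := ∑ k ∈ Finset.range n, ∫⁻ x, Q k x ∂P + ∫⁻ x, (∑ k ∈ Finset.range n, V k x) ^ σ ∂P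
      with hR
    by_cases hRfin : R = ∞
    · rw [hRfin, ENNReal.mul_top (by simp)]
      exact le_top
    have hmWV : ∀ k, Measurable fun x => W k x ^ (σ - 1) * V k x := fun k =>
      ((hWm k).pow_const _).mul (hVm k)
    set Vs : (ℕ → S) → ℝ≥0∞ := fun x => ∑ k ∈ Finset.range n, V k x with hVs
    have hVsm : Measurable Vs := Finset.measurable_sum _ fun k _ => hVm k
    set M : (ℕ → S) → ℝ≥0∞ := fun x => (Finset.range (n + 1)).sup fun k => W k x with hM
    have hsum : ∀ k ≤ n, ∫⁻ x, W k x ^ σ ∂P ≤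
        C₁ * (∑ j ∈ Finset.range k, (∫⁻ x, W j x ^ (σ - 1) * V j x ∂P + ∫⁻ x, Q j x ∂P)) := by
      intro k hk
      induction k with
      | zero => simp [hW0, hσ0]
      | succ k ih =>
        refine (hrec k).trans ((add_le_add_left (ih (by omega)) _).trans (le_of_eq ?_))
        rw [Finset.sum_range_succ]
        ring
    have hVsR : ∫⁻ x, Vs x ^ σ ∂P ≤ R := le_add_self
    have hVfin : ∀ k < n, ∫⁻ x, V k x ^ σ ∂P ≠ ∞ := fun k hk => by
      refine ne_top_of_le_ne_top hRfin (le_trans (lintegral_mono fun x => ?_) hVsR)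
      exact ENNReal.rpow_le_rpow (Finset.single_le_sum (f := fun k => V k x)
        (fun _ _ => zero_le) (Finset.mem_range.2 hk)) hσ0.le
    have hQfin : ∀ k < n, ∫⁻ x, Q k x ∂P ≠ ∞ := fun k hk =>
      ne_top_of_le_ne_top hRfin (le_add_right (Finset.single_le_sum
        (f := fun k => ∫⁻ x, Q k x ∂P) (fun _ _ => zero_le) (Finset.mem_range.2 hk)))
    -- Finiteness is needed in order to absorb a multiple of `E (W_n ^ σ)` into the left-hand side.
    have hfin : ∀ k ≤ n, ∫⁻ x, W k x ^ σ ∂P ≠ ∞ := by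
      intro k hk
      induction k with
      | zero => simp [hW0, hσ0]
      | succ k ih =>
        refine ne_top_of_le_ne_top ?_ (hrec k)
        have h1 : ∫⁻ x, W k x ^ (σ - 1) * V k x ∂P ≠ ∞ := by
          refine ne_top_of_le_ne_top ?_ (lintegral_mono fun x => hC₂ (W k x) (V k x))
          rw [lintegral_add_left (((hWm k).pow_const _).const_mul _),
            lintegral_const_mul _ ((hWm k).pow_const _), lintegral_const_mul _ ((hVm k).pow_const _)]
          exact ENNReal.add_ne_top.2 ⟨ENNReal.mul_ne_top ENNReal.coe_ne_top (ih (by omega)),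
            ENNReal.mul_ne_top ENNReal.coe_ne_top (hVfin k hk)⟩
        exact ENNReal.add_ne_top.2 ⟨ih (by omega), ENNReal.mul_ne_top ENNReal.coe_ne_top
          (ENNReal.add_ne_top.2 ⟨h1, hQfin k hk⟩)⟩
    -- Each `W j` is bounded by the running maximum `M`, so that the `V j` add up to `Vs`; then
    -- Young separates `M` from `Vs`, and Doob returns from `M` to `W n`.
    have hWV : ∑ j ∈ Finset.range n, ∫⁻ x, W j x ^ (σ - 1) * V j x ∂P ≤
        (1 / (2 * (C₁ + 1) * (K₁ + 1)) : ℝ≥0) * (K₁ * ∫⁻ x, W n x ^ σ ∂P) + C₂ * R := by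
      rw [← lintegral_finsetSum _ fun k _ => hmWV k]
      calc ∫⁻ x, ∑ j ∈ Finset.range n, W j x ^ (σ - 1) * V j x ∂P
          ≤ ∫⁻ x, M x ^ (σ - 1) * Vs x ∂P := by
            refine lintegral_mono fun x => ?_
            rw [hVs, Finset.mul_sum]
            refine Finset.sum_le_sum fun j hj => ?_
            gcongr
            exact Finset.le_sup (f := fun k => W k x)
                (Finset.mem_range.2 ((Finset.mem_range.1 hj).trans (Nat.lt_succ_self n)))
        _ ≤ ∫⁻ x, ((1 / (2 * (C₁ + 1) * (K₁ + 1)) : ℝ≥0) * M x ^ σ + C₂ * Vs x ^ σ) ∂P :=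
            lintegral_mono fun x => hC₂ _ _
        _ = (1 / (2 * (C₁ + 1) * (K₁ + 1)) : ℝ≥0) * ∫⁻ x, M x ^ σ ∂P + C₂ * ∫⁻ x, Vs x ^ σ ∂P := by
            rw [lintegral_add_right _ ((hVsm.pow_const _).const_mul _),
              lintegral_const_mul' _ _ ENNReal.coe_ne_top,
              lintegral_const_mul _ (hVsm.pow_const _)]
        _ ≤ _ := by gcongr
    have hQR : ∑ j ∈ Finset.range n, ∫⁻ x, Q j x ∂P ≤ R := le_self_add
    have key := hsum n le_rfl
    rw [Finset.sum_add_distrib] at key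
    have key2 := key.trans (mul_le_mul_right (add_le_add hWV hQR) _)
    have hA := hfin n le_rfl
    lift ∫⁻ x, W n x ^ σ ∂P to ℝ≥0 using hA with A
    lift R to ℝ≥0 using hRfin with R'
    norm_cast at key2 ⊢
    rw [← NNReal.coe_le_coe] at key2 ⊢
    push_cast at key2 ⊢
    have hA0 : (0 : ℝ) ≤ A := A.2
    have hR0 : (0 : ℝ) ≤ R' := R'.2
    have e1 : (C₁ : ℝ) * (1 / (2 * (C₁ + 1) * (K₁ + 1)) * (K₁ * A) + C₂ * R' + R') ≤
        A / 2 + C₁ * (C₂ + 1) * R' := by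
      have : (C₁ : ℝ) * (1 / (2 * (C₁ + 1) * (K₁ + 1)) * (K₁ * A)) ≤ A / 2 := by
        rw [show (C₁ : ℝ) * (1 / (2 * (C₁ + 1) * (K₁ + 1)) * (K₁ * A)) =
          (C₁ * K₁ * A) / (2 * (C₁ + 1) * (K₁ + 1)) by ring, div_le_div_iff₀ (by positivity)
          two_pos]
        have h1 : (0 : ℝ) ≤ C₁ * A := by positivity
        have h2 : (0 : ℝ) ≤ K₁ * A := by positivity
        nlinarith
      linarith
    have := key2.trans e1
    nlinarith

/-! ### Iterated sums of degenerate kernels -/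

/-- The kernel `h`, a function of the index-value pairs `z 0, z 1, …`, summed over the pairs
`(k, x k)`, `k < N`, in each of the first `j` arguments. -/
noncomputable def partialSum {S : Type v} {B : Type w} [NormedAddCommGroup B] (N : ℕ)
    (h : (ℕ → ℕ × S) → B) : ℕ → (ℕ → S) → (ℕ → ℕ × S) → B
  | 0, _, z => h z
  | j + 1, x, z => ∑ k ∈ Finset.range N, partialSum N h j x (Function.update z j (k, x k))

section

variable {S : Type v} {B : Type w} [NormedAddCommGroup B] {N : ℕ} {h : (ℕ → ℕ × S) → B} {m : ℕ}

theorem measurable_partialSum [MeasurableSpace S] [MeasurableSpace B] [BorelSpace B]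
    [SecondCountableTopology B] (hh : Measurable h) (j : ℕ) :
    Measurable fun w : (ℕ → S) × (ℕ → ℕ × S) => partialSum N h j w.1 w.2 := by
  induction j with
  | zero => exact hh.comp measurable_snd
  | succ j ih =>
    refine Finset.measurable_sum _ fun k _ => ?_
    have hu : Measurable fun w : (ℕ → S) × (ℕ → ℕ × S) => Function.update w.2 j (k, w.1 k) :=
      measurable_update'.comp (measurable_snd.prodMk
        (measurable_const.prodMk ((measurable_pi_apply k).comp measurable_fst)))
    exact ih.comp (measurable_fst.prodMk hu)

/-- The first `j` summations leave the arguments `l` and `l + 1` alone, so every summand violates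
the ordering of the indices. -/
theorem partialSum_eq_zero
    (hz : ∀ z l, l + 1 < m → (z (l + 1)).1 ≤ (z l).1 → h z = 0) (x : ℕ → S) {j l : ℕ} (hjl : j ≤ l)
    (hl : l + 1 < m) {z : ℕ → ℕ × S} (hle : (z (l + 1)).1 ≤ (z l).1) :
    partialSum N h j x z = 0 := by
  induction j generalizing z with
  | zero => exact hz z l hl hle
  | succ j ih =>
    refine Finset.sum_eq_zero fun k _ => ih (by omega) ?_
    rwa [Function.update_of_ne (by omega), Function.update_of_ne (by omega)]

/-- Only indices below that of the argument `j` contribute, so the sum is a function of the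
variables preceding it. This is the predictability that Rosenthal's inequality requires. -/
theorem partialSum_update
    (hz : ∀ z l, l + 1 < m → (z (l + 1)).1 ≤ (z l).1 → h z = 0) (x : ℕ → S) {j : ℕ} (hj : j < m)
    {z : ℕ → ℕ × S} {i : ℕ} (hi : (z j).1 ≤ i) (t : S) :
    partialSum N h j (Function.update x i t) z = partialSum N h j x z := by
  induction j generalizing z with
  | zero => rfl
  | succ j ih =>
    refine Finset.sum_congr rfl fun k _ => ?_
    rcases lt_or_ge k (z (j + 1)).1 with hk | hk
    · rw [Function.update_of_ne (by omega : k ≠ i)]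
      refine ih (by omega) ?_
      rw [Function.update_self]
      exact (hk.trans_le hi).le
    · rw [partialSum_eq_zero hz _ le_rfl hj, partialSum_eq_zero hz _ le_rfl hj] <;>
      rwa [Function.update_self, Function.update_of_ne (by omega)]

/-- Replacing the argument `l` commutes with the summations over the earlier arguments, so centering
is inherited term by term. -/
theorem partialSum_centered [NormedSpace ℝ B] [MeasurableSpace S] {μ : Measure S}
    (hc : ∀ z l k, l < m → Integrable (fun t => h (Function.update z l (k, t))) μ ∧
      ∫ t, h (Function.update z l (k, t)) ∂μ = 0) (x : ℕ → S) {j l : ℕ} (hjl : j ≤ l)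
    (hl : l < m) (z : ℕ → ℕ × S) (k : ℕ) :
    Integrable (fun t => partialSum N h j x (Function.update z l (k, t))) μ ∧
      ∫ t, partialSum N h j x (Function.update z l (k, t)) ∂μ = 0 := by
  induction j generalizing z with
  | zero => exact hc z l k hl
  | succ j ih =>
    have e : ∀ i t, Function.update (Function.update z l (k, t)) j (i, x i) =
        Function.update (Function.update z j (i, x i)) l (k, t) := fun i t =>
      Function.update_comm (by omega) _ _ _
    simp only [partialSum, e]
    refine ⟨integrable_finsetSum _ fun i _ => (ih (by omega) _).1, ?_⟩
    rw [integral_finsetSum _ fun i _ => (ih (by omega) _).1]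
    exact Finset.sum_eq_zero fun i _ => (ih (by omega) _).2

end

/-- Extending the sum to all indices turns summation over indices and integration over values into
one integral over pairs. -/
theorem sum_range_lintegral_le {S : Type*} [MeasurableSpace S] {μ : Measure S} [SFinite μ] (N : ℕ)
    {f : ℕ × S → ℝ≥0∞} (hf : Measurable f) :
    ∑ k ∈ Finset.range N, ∫⁻ t, f (k, t) ∂μ ≤ ∫⁻ z, f z ∂(Measure.count.prod μ) := by
  rw [lintegral_prod _ hf.aemeasurable, lintegral_count]
  exact ENNReal.sum_le_tsum _

/-- The moment inequality for degenerate sums over index tuples: the moments are bounded by mixed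
norms of the kernel. -/
theorem Seminorm.exists_partialSum_moment {B : Type w} [NormedAddCommGroup B] [NormedSpace ℝ B]
    {nu : Seminorm ℝ B} {p : ℝ} [CompleteSpace B] [MeasurableSpace B] [BorelSpace B]
    [SecondCountableTopology B] (hnu : Continuous nu) (hp1 : 1 < p) (hp2 : p ≤ 2) {C : ℝ}
    (hC : 0 ≤ C)
    (h2 : ∀ x y : B, nu (x + y) ^ p + nu (x - y) ^ p ≤ 2 * nu x ^ p + C * nu y ^ p)
    (σ : ℝ) (hσ : 1 ≤ σ) :
    ∃ K : ℝ≥0, ∀ (S : Type v) [MeasurableSpace S] (μ : Measure S) [IsProbabilityMeasure μ]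
      (m N : ℕ) (h : (ℕ → ℕ × S) → B), Measurable h →
      (∀ z l, l + 1 < m → (z (l + 1)).1 ≤ (z l).1 → h z = 0) →
      (∀ z l k, l < m → Integrable (fun t => h (Function.update z l (k, t))) μ ∧
        ∫ t, h (Function.update z l (k, t)) ∂μ = 0) →
      ∀ j ≤ m, ∀ I : Finset ℕ, (∀ i ∈ I, j ≤ i) → ∀ z,
      ∫⁻ x, lmarginal (fun _ => Measure.count.prod μ) I
          (fun z => nu.epow p (partialSum N h j x z)) z ^ σ ∂(Measure.infinitePi fun _ : ℕ => μ) ≤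
        K ^ j * ∑ J ∈ (Finset.range j).powerset, lmarginal (fun _ => Measure.count.prod μ) J
          (fun z => lmarginal (fun _ => Measure.count.prod μ) (Finset.range j \ J ∪ I)
            (fun z => nu.epow p (h z)) z ^ σ) z := by
  obtain ⟨K, hK⟩ := Seminorm.exists_rosenthal.{v, w} hnu hp1 hp2 hC h2 σ hσ
  refine ⟨K, fun S _ μ _ m N h hh hz hc j => ?_⟩
  have hg : Measurable (nu.epow p) := Seminorm.measurable_epow hnu
  set lam : ℕ → Measure (ℕ × S) := fun _ => Measure.count.prod μ with hlam
  set P := Measure.infinitePi fun _ : ℕ => μ with hP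
  have hgh : Measurable fun z => nu.epow p (h z) := hg.comp hh
  have hF : ∀ J I, Measurable (lmarginal lam J (fun z => lmarginal lam I
      (fun z => nu.epow p (h z)) z ^ σ)) := fun J I =>
    Measurable.lmarginal _ ((Measurable.lmarginal _ hgh).pow_const _)
  induction j with
  | zero =>
    intro _ I _ z
    simp [partialSum, hP]
  | succ j ih =>
    intro hj I hI z
    have hjI : j ∉ I := fun h => by have := hI j h; omega
    have ih := ih (by omega)
    have hps : Measurable fun w : (ℕ → S) × (ℕ → ℕ × S) => nu.epow p (partialSum N h j w.1 w.2) :=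
      hg.comp (measurable_partialSum hh j)
    have hpsx : ∀ x, Measurable fun z => nu.epow p (partialSum N h j x z) := fun x =>
      hps.comp measurable_prodMk_left
    have hupd : ∀ y k t, Function.update (Function.updateFinset z I y) j (k, t) =
        Function.updateFinset (Function.update z j (k, t)) I y := by
      intro y k t
      ext1 i
      by_cases hij : i = j
      · subst hij
        simp [Function.updateFinset, hjI]
      · by_cases hi : i ∈ I <;> simp [Function.updateFinset, hij, hi]
    have hmeas : ∀ k, Measurable fun w : (ℕ → S) × S × (∀ _ : I, ℕ × S) =>
        Function.update (Function.updateFinset z I w.2.2) j (k, w.2.1) := fun k =>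
      measurable_update'.comp ((measurable_updateFinset.comp
        (measurable_snd.comp measurable_snd)).prodMk
        (measurable_const.prodMk (measurable_fst.comp measurable_snd)))
    -- The martingale runs over the index `k` of the argument `j`; the arguments in `I`, already
    -- moved inside the power, are the variables of the `L^p` space.
    have ros := hK (∀ _ : I, ℕ × S) S (Measure.pi fun i : I => lam i) μ
      (fun k x t y => partialSum N h j x (Function.update (Function.updateFinset z I y) j (k, t)))
      (fun k => (measurable_partialSum hh j).comp (measurable_fst.prodMk (hmeas k)))
      (fun k x i t s y hki => partialSum_update hz x (by omega)
        (by rw [Function.update_self]; exact hki) t)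
      (fun k x y => (partialSum_centered hc x le_rfl (by omega) _ k).1)
      (fun k x y => (partialSum_centered hc x le_rfl (by omega) _ k).2) N
    refine ros.trans ?_
    simp only [hupd]
    have hx1 : ∀ I : Finset ℕ, Measurable fun w : (ℕ → S) × (ℕ → ℕ × S) =>
        lmarginal lam I (fun z => nu.epow p (partialSum N h j w.1 z)) w.2 := fun I =>
      Measurable.lintegral_prod_right' (f := fun w : ((ℕ → S) × (ℕ → ℕ × S)) × (∀ _ : I, ℕ × S) =>
          nu.epow p (partialSum N h j w.1.1 (Function.updateFinset w.1.2 I w.2)))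
        (hps.comp ((measurable_fst.comp measurable_fst).prodMk
          (measurable_updateFinset'.comp
            ((measurable_snd.comp measurable_fst).prodMk measurable_snd))))
    -- Sum of the moments of the differences: the argument `j` stays outside the power, so the
    -- induction hypothesis is used with the same `I` at each fixed `(k, t)`.
    have first : ∑ k ∈ Finset.range N, ∫⁻ x, ∫⁻ t, lmarginal lam I
        (fun z => nu.epow p (partialSum N h j x z)) (Function.update z j (k, t)) ^ σ ∂μ ∂P ≤
        K ^ j * ∑ J ∈ (Finset.range j).powerset, lmarginal lam (insert j J)
          (fun z => lmarginal lam (Finset.range j \ J ∪ I) (fun z => nu.epow p (h z)) z ^ σ) z := by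
      have hsum : Measurable fun z => ∑ J ∈ (Finset.range j).powerset, lmarginal lam J
          (fun z => lmarginal lam (Finset.range j \ J ∪ I) (fun z => nu.epow p (h z)) z ^ σ) z :=
        Finset.measurable_sum _ fun J _ => hF J _
      have hFu : ∀ J, Measurable fun w => lmarginal lam J
          (fun z => lmarginal lam (Finset.range j \ J ∪ I) (fun z => nu.epow p (h z)) z ^ σ)
          (Function.update z j w) := fun J => (hF J _).comp (measurable_update z)
      calc _ ≤ ∑ k ∈ Finset.range N, ∫⁻ t, K ^ j * ∑ J ∈ (Finset.range j).powerset, lmarginal lam J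
            (fun z => lmarginal lam (Finset.range j \ J ∪ I) (fun z => nu.epow p (h z)) z ^ σ)
            (Function.update z j (k, t)) ∂μ := by
            refine Finset.sum_le_sum fun k _ => ?_
            rw [lintegral_lintegral_swap]
            · exact lintegral_mono fun t => ih I (fun i hi => by have := hI i hi; omega) _
            · refine (((hx1 I).comp (measurable_fst.prodMk ?_)).pow_const σ).aemeasurable
              exact (measurable_update z).comp (measurable_const.prodMk measurable_snd)
        _ ≤ ∫⁻ w, K ^ j * ∑ J ∈ (Finset.range j).powerset, lmarginal lam J
            (fun z => lmarginal lam (Finset.range j \ J ∪ I) (fun z => nu.epow p (h z)) z ^ σ)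
            (Function.update z j w) ∂(lam j) :=
            sum_range_lintegral_le N ((hsum.comp (measurable_update z)).const_mul _)
        _ = _ := by
            rw [lintegral_const_mul' _ _ (by finiteness),
              lintegral_finsetSum _ fun J _ => hFu J]
            congr 1
            refine Finset.sum_congr rfl fun J hJ => ?_
            have hjJ : j ∉ J := fun h => by
              have := Finset.mem_range.1 (Finset.mem_powerset.1 hJ h)
              omega
            rw [lmarginal_insert _ ((Measurable.lmarginal _ hgh).pow_const _) hjJ]
    -- Predictable term: the sum and integral over the argument `j` are inside the power, so `j`
    -- joins `I` before the induction hypothesis is used.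
    have second : ∫⁻ x, (∑ k ∈ Finset.range N, ∫⁻ t, lmarginal lam I
        (fun z => nu.epow p (partialSum N h j x z)) (Function.update z j (k, t)) ∂μ) ^ σ ∂P ≤
        K ^ j * ∑ J ∈ (Finset.range j).powerset, lmarginal lam J
          (fun z => lmarginal lam (Finset.range j \ J ∪ insert j I)
            (fun z => nu.epow p (h z)) z ^ σ) z := by
      refine le_trans (lintegral_mono fun x => ?_) (ih (insert j I) ?_ z)
      · refine ENNReal.rpow_le_rpow ?_ (by linarith)
        rw [lmarginal_insert _ (hpsx x) hjI]
        exact sum_range_lintegral_le N ((Measurable.lmarginal _ (hpsx x)).comp (measurable_update z))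
      · intro i hi
        rcases Finset.mem_insert.1 hi with rfl | hi
        · exact le_rfl
        · have := hI i hi; omega
    refine (mul_le_mul_right ((add_comm _ _).trans_le (add_le_add second first)) _).trans
      (le_of_eq ?_)
    -- The subsets of `range (j + 1)` are split according to whether they contain `j`: `second`
    -- yields those without `j`, `first` those with it.
    rw [← mul_add, ← mul_assoc, ← pow_succ', Finset.range_add_one, Finset.sum_powerset_insert
      Finset.notMem_range_self]
    congr 2
    · refine Finset.sum_congr rfl fun J hJ => ?_
      have hjJ : j ∉ J := fun h => by
        have := Finset.mem_range.1 (Finset.mem_powerset.1 hJ h)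
        omega
      have e : Finset.range j \ J ∪ insert j I = insert j (Finset.range j) \ J ∪ I := by
        ext i
        simp only [Finset.mem_union, Finset.mem_sdiff, Finset.mem_insert]
        constructor
        · rintro (⟨h1, h3⟩ | rfl | h1) <;> tauto
        · rintro (⟨rfl | h1, h3⟩ | h1) <;> tauto
      rw [e]
    · refine Finset.sum_congr rfl fun J hJ => ?_
      have e : Finset.range j \ J = insert j (Finset.range j) \ insert j J := by
        ext i
        simp only [Finset.mem_sdiff, Finset.mem_insert, Finset.mem_range]
        constructor
        · rintro ⟨h1, h3⟩
          exact ⟨Or.inr h1, by rintro (rfl | h4) <;> [omega; exact h3 h4]⟩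
        · rintro ⟨h1, h3⟩
          exact ⟨h1.resolve_left fun h4 => h3 (Or.inl h4), fun h4 => h3 (Or.inr h4)⟩
      rw [e]

/-! ### Null sets and conditional expectations as partial integrals -/

/-- A function whose averages over single coordinates vanish almost everywhere agrees almost
everywhere with a function for which they vanish everywhere. -/
theorem exists_ae_eq_centered {ι S B : Type*} [Fintype ι] [DecidableEq ι] [MeasurableSpace S]
    {μ : Measure S} [IsProbabilityMeasure μ] [NormedAddCommGroup B] [NormedSpace ℝ B]
    [MeasurableSpace B] {h : (ι → S) → B} (hh : Measurable h)
    (hae : ∀ l, ∀ᵐ x ∂(Measure.infinitePi fun _ : ι => μ),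
      Integrable (fun t => h (Function.update x l t)) μ ∧
        ∫ t, h (Function.update x l t) ∂μ = 0) :
    ∃ h' : (ι → S) → B, Measurable h' ∧ h' =ᵐ[Measure.infinitePi fun _ : ι => μ] h ∧
      ∀ l x, Integrable (fun t => h' (Function.update x l t)) μ ∧
        ∫ t, h' (Function.update x l t) ∂μ = 0 := by
  set P := Measure.infinitePi fun _ : ι => μ with hP
  have hupd : ∀ l : ι, Measurable fun z : (ι → S) × S => Function.update z.1 l z.2 := fun l =>
    measurable_update'
  obtain ⟨E, hE, hEm, hE0⟩ := exists_measurable_superset_of_null (ae_iff.1 (ae_all_iff.2 hae))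
  -- remove the points with a non-negligible part of a section outside
  let T : Set (ι → S) → Set (ι → S) := fun A =>
    A ∩ ⋂ l : ι, {x | μ {t | Function.update x l t ∉ A} = 0}
  -- Removing points may spoil the sections of the remaining ones, so the removal is iterated. In
  -- the intersection `G` of all stages, every section through a point of `G` lies almost entirely
  -- in `G`.
  let A : ℕ → Set (ι → S) := fun n => T^[n] Eᶜ
  have hA1 : ∀ n, A (n + 1) = T (A n) := fun n => Function.iterate_succ_apply' _ _ _
  have hAm : ∀ n, MeasurableSet (A n) := by
    intro n
    induction n with
    | zero => exact hEm.compl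
    | succ n ih =>
      rw [hA1]
      refine ih.inter (MeasurableSet.iInter fun l => ?_)
      exact measurableSet_eq_fun (measurable_measure_prodMk_left ((hupd l) ih.compl))
        measurable_const
  have hA0 : ∀ n, ∀ᵐ x ∂P, x ∈ A n := by
    intro n
    induction n with
    | zero => exact measure_eq_zero_iff_ae_notMem.1 hE0
    | succ n ih =>
      rw [hA1]
      have h1 : ∀ l : ι, ∀ᵐ x ∂P, ∀ᵐ t ∂μ, Function.update x l t ∈ A n := fun l =>
        Measure.ae_ae_of_ae_prod
          ((measurePreserving_update_infinitePi μ l).quasiMeasurePreserving.ae ih)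
      filter_upwards [ih, ae_all_iff.2 h1] with x hx hx1
      exact ⟨hx, Set.mem_iInter.2 fun l => hx1 l⟩
  set G := ⋂ n, A n with hG
  have hGm : MeasurableSet G := MeasurableSet.iInter hAm
  have hsec : ∀ x ∈ G, ∀ l, ∀ᵐ t ∂μ, Function.update x l t ∈ G := by
    intro x hx l
    have h1 : ∀ n, ∀ᵐ t ∂μ, Function.update x l t ∈ A n := fun n => by
      have h2 := Set.mem_iInter.1 hx (n + 1)
      rw [hA1] at h2
      exact Set.mem_iInter.1 h2.2 l
    filter_upwards [ae_all_iff.2 h1] with t ht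
    exact Set.mem_iInter.2 ht
  have hgood : ∀ x ∈ G, ∀ l, Integrable (fun t => h (Function.update x l t)) μ ∧
      ∫ t, h (Function.update x l t) ∂μ = 0 := by
    intro x hx
    have h1 : x ∉ E := Set.mem_iInter.1 hx 0
    by_contra hne
    exact h1 (hE hne)
  refine ⟨G.indicator h, hh.indicator hGm, ?_, fun l x => ?_⟩
  · filter_upwards [ae_all_iff.2 hA0] with x hx
    exact Set.indicator_of_mem (Set.mem_iInter.2 hx) _
  -- A section that meets `G` lies in it up to a null set, so nothing changes along it; on a section
  -- that misses `G` the new function is zero.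
  · by_cases hex : ∃ s, Function.update x l s ∈ G
    · obtain ⟨s, hs⟩ := hex
      have h1 := hsec _ hs l
      have h2 := hgood _ hs l
      simp only [Function.update_idem] at h1 h2
      have h3 : (fun t => h (Function.update x l t)) =ᵐ[μ]
          fun t => G.indicator h (Function.update x l t) := by
        filter_upwards [h1] with t ht
        rw [Set.indicator_of_mem ht]
      exact ⟨h2.1.congr h3, (integral_congr_ae h3).symm.trans h2.2⟩
    · push Not at hex
      simp [Set.indicator_of_notMem (hex _)]

/-- Filling the coordinates outside `J` with a fixed point does not change `f`, which exhibits it as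
a function of the `ξ j`, `j ∈ J`. -/
theorem measurable_firstVars_sigmaOf {Ω : Type u} {S : Type v} [MeasurableSpace S] {ξ : ℕ → Ω → S}
    {m : ℕ} (hs : Nonempty S) {E : Type*} [MeasurableSpace E]
    {f : (Fin m → S) → E} (hf : Measurable f)
    {J : Finset (Fin m)} (hdep : ∀ x y, (∀ j ∈ J, x j = y j) → f x = f y) :
    Measurable[sigmaOf ξ J] fun ω => f (firstVars ξ m ω) := by
  obtain ⟨s⟩ := hs
  have h1 : (fun ω => f (firstVars ξ m ω)) =
      (fun y : J → S => f (Function.updateFinset (fun _ => s) J y)) ∘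
        fun ω (j : J) => ξ (j : Fin m) ω := by
    ext1 ω
    refine hdep _ _ fun j hj => ?_
    simp [Function.updateFinset, hj, firstVars]
  rw [h1]
  exact (hf.comp measurable_updateFinset).comp (comap_measurable _)

/-- Sets in the σ-algebra of `ξ j`, `j ∈ J`, are preimages of sets that do not depend on the
other coordinates. -/
theorem exists_preimage_firstVars {Ω : Type u} {S : Type v} [MeasurableSpace S] {ξ : ℕ → Ω → S}
    {m : ℕ} {J : Finset (Fin m)} {s : Set Ω}
    (hs : MeasurableSet[sigmaOf ξ J] s) :
    ∃ E : Set (Fin m → S), MeasurableSet E ∧ s = firstVars ξ m ⁻¹' E ∧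
      ∀ x y, (∀ j ∈ J, x j = y j) → (x ∈ E ↔ y ∈ E) := by
  obtain ⟨E, hE, rfl⟩ := hs
  refine ⟨(fun x (j : J) => x j) ⁻¹' E,
    (measurable_pi_iff.2 fun j : J => measurable_pi_apply (j : Fin m)) hE, rfl, fun x y hxy => ?_⟩
  have : (fun j : J => x j) = fun j : J => y j := funext fun j => hxy j j.2
  simp only [Set.mem_preimage, this]

section

variable {Ω : Type u} [MeasurableSpace Ω] {S : Type v} [MeasurableSpace S] {P : Measure Ω}
  {ξ : ℕ → Ω → S} {m : ℕ}

theorem IsIIDSeq.isProbabilityMeasure [IsProbabilityMeasure P] (hξ : IsIIDSeq ξ P) : IsProbabilityMeasure (P.map (ξ 0)) :=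
  Measure.isProbabilityMeasure_map (hξ.measurable 0).aemeasurable

theorem IsIIDSeq.measurable_firstVars (hξ : IsIIDSeq ξ P) : Measurable (firstVars ξ m) :=
  measurable_pi_iff.2 fun l => hξ.measurable l

theorem IsIIDSeq.map_comp {ι : Type*} (hξ : IsIIDSeq ξ P) {i : ι → ℕ} (hi : Function.Injective i) :
    P.map (fun ω l => ξ (i l) ω) = Measure.infinitePi fun _ : ι => P.map (ξ 0) := by
  have h0 : iIndepFun (fun l : ι => ξ (i l)) P := hξ.indep.precomp hi
  have h := iIndepFun.map_fun_eq_infinitePi_map (X := fun l : ι => ξ (i l))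
    (fun l => hξ.measurable (i l)) h0
  refine h.trans ?_
  congr 1
  ext1 l
  exact (hξ.identDistrib (i l)).map_eq

theorem IsIIDSeq.map_firstVars (hξ : IsIIDSeq ξ P) :
    P.map (firstVars ξ m) = Measure.infinitePi fun _ : Fin m => P.map (ξ 0) :=
  hξ.map_comp Fin.val_injective

theorem IsIIDSeq.sigmaOf_le (hξ : IsIIDSeq ξ P) (J : Finset (Fin m)) :
    sigmaOf ξ J ≤ ‹MeasurableSpace Ω› :=
  (measurable_pi_iff.2 fun j : J => hξ.measurable (j : Fin m)).comap_le

/-- Conditional expectations of functions of `ξ_1, …, ξ_m` are partial integrals. -/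
theorem IsIIDSeq.condLExp_eq [IsProbabilityMeasure P] (hξ : IsIIDSeq ξ P) (J : Finset (Fin m))
    {f : (Fin m → S) → ℝ≥0∞} (hf : Measurable f) :
    condLExp (sigmaOf ξ J) P (fun ω => f (firstVars ξ m ω)) =ᵐ[P]
      fun ω => lmarginal (fun _ => P.map (ξ 0)) Jᶜ f (firstVars ξ m ω) := by
  have := hξ.isProbabilityMeasure
  have hS : Nonempty S := (nonempty_of_isProbabilityMeasure P).map (ξ 0)
  have hmF := hξ.measurable_firstVars (m := m)
  have hle := hξ.sigmaOf_le J
  have hmarg : Measurable (lmarginal (fun _ => P.map (ξ 0)) Jᶜ f) := Measurable.lmarginal _ hf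
  refine (ae_eq_condLExp (hm := hle) P _ ?_ fun s hs => ?_).symm
  · refine measurable_firstVars_sigmaOf hS hmarg fun x y hxy => ?_
    exact lmarginal_congr _ _ fun i hi => hxy i (by simpa using hi)
  · obtain ⟨E, hE, rfl, hEdep⟩ := exists_preimage_firstVars hs
    rw [← setLIntegral_map hE hmarg hmF, ← setLIntegral_map hE hf hmF, hξ.map_firstVars,
      Measure.infinitePi_eq_pi, ← lintegral_indicator hE, ← lintegral_indicator hE]
    -- The set `E` does not see the coordinates in `Jᶜ`, so integrating these out leaves the same
    -- function on both sides.
    refine lintegral_eq_of_lmarginal_eq Jᶜ (hmarg.indicator hE) (hf.indicator hE) ?_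
    have hEu : ∀ (x : Fin m → S) y, Function.updateFinset x Jᶜ y ∈ E ↔ x ∈ E := fun x y =>
      hEdep _ _ fun j hj => by simp [Function.updateFinset, hj]
    ext x
    by_cases hx : x ∈ E
    · simp only [lmarginal, Set.indicator, hEu, hx, if_true]
      have h2 : ∀ y : (Jᶜ : Finset (Fin m)) → S,
          lmarginal (fun _ => P.map (ξ 0)) Jᶜ f (Function.updateFinset x Jᶜ y) =
          lmarginal (fun _ => P.map (ξ 0)) Jᶜ f x := fun y =>
        lmarginal_congr _ _ fun i hi => by simp [Function.updateFinset, hi]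
      simp only [lmarginal] at h2
      simp only [h2, lintegral_const, measure_univ, mul_one]
    · simp only [lmarginal, Set.indicator, hEu, hx, if_false]

/-- A degenerate kernel is centered in every coordinate, almost everywhere. -/
theorem IsDegenerated.ae_centered [IsProbabilityMeasure P] {B : Type w} [NormedAddCommGroup B] [NormedSpace ℝ B]
    [CompleteSpace B] [MeasurableSpace B] [BorelSpace B] [SecondCountableTopology B]
    {h : (Fin m → S) → B} (hd : IsDegenerated h ξ P) (hξ : IsIIDSeq ξ P) (hh : Measurable h)
    (l : Fin m) :
    ∀ᵐ x ∂(Measure.infinitePi fun _ : Fin m => P.map (ξ 0)),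
      Integrable (fun t => h (Function.update x l t)) (P.map (ξ 0)) ∧
        ∫ t, h (Function.update x l t) ∂(P.map (ξ 0)) = 0 := by
  have := hξ.isProbabilityMeasure
  have hS : Nonempty S := (nonempty_of_isProbabilityMeasure P).map (ξ 0)
  have hmF := hξ.measurable_firstVars (m := m)
  have hmap := hξ.map_firstVars (m := m)
  have hle := hξ.sigmaOf_le ({l}ᶜ : Finset (Fin m))
  set μ := P.map (ξ 0) with hμ
  set Q := Measure.infinitePi fun _ : Fin m => μ with hQ
  have hmp := measurePreserving_update_infinitePi (ι := Fin m) μ l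
  have hi : Integrable h Q := by
    rw [← hmap]
    exact (integrable_map_measure hh.aestronglyMeasurable hmF.aemeasurable).2 hd.integrable
  have hres : ∀ f : (Fin m → S) → B, Measurable f → Integrable f Q →
      Integrable (fun z : (Fin m → S) × S => f (Function.update z.1 l z.2)) (Q.prod μ) ∧
      ∫ x, f x ∂Q = ∫ x, ∫ t, f (Function.update x l t) ∂μ ∂Q := by
    intro f hf hfi
    have h1 : Integrable (fun z : (Fin m → S) × S => f (Function.update z.1 l z.2)) (Q.prod μ) :=
      hmp.integrable_comp_of_integrable hfi
    refine ⟨h1, ?_⟩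
    rw [← integral_prod _ h1]
    have h2 := integral_map hmp.measurable.aemeasurable
      (f := f) (μ := Q.prod μ) (by rw [hmp.map_eq]; exact hf.aestronglyMeasurable)
    rwa [hmp.map_eq] at h2
  set c : (Fin m → S) → B := fun x => ∫ t, h (Function.update x l t) ∂μ with hc
  have hcm : Measurable c :=
    (StronglyMeasurable.integral_prod_right'
      (f := fun z : (Fin m → S) × S => h (Function.update z.1 l z.2))
      (hh.comp measurable_update').stronglyMeasurable).measurable
  have hcdep : ∀ x y : Fin m → S, (∀ j ∈ ({l}ᶜ : Finset (Fin m)), x j = y j) → c x = c y := by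
    intro x y hxy
    have : ∀ t, Function.update x l t = Function.update y l t := fun t => by
      ext1 j
      by_cases hj : j = l
      · subst hj; simp
      · rw [Function.update_of_ne hj, Function.update_of_ne hj, hxy j (by simpa using hj)]
    simp only [hc, this]
  have hci : Integrable c Q := (hres h hh hi).1.integral_prod_left
  -- The partial integral `c` is a version of the conditional expectation given the variables other
  -- than the `l`-th, which vanishes by degeneracy.
  have key : (fun ω => c (firstVars ξ m ω)) =ᵐ[P] 0 := by
    refine (ae_eq_condExp_of_forall_setIntegral_eq hle hd.integrable (fun s _ _ => ?_)
      (fun s hs _ => ?_) ?_).trans (hd.condExp_eq_zero l)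
    · refine Integrable.integrableOn ?_
      exact (integrable_map_measure hcm.aestronglyMeasurable hmF.aemeasurable).1
        (by rw [hmap]; exact hci)
    · obtain ⟨E, hE, rfl, hEdep⟩ := exists_preimage_firstVars hs
      rw [← setIntegral_map hE (by exact hcm.aestronglyMeasurable) hmF.aemeasurable,
        ← setIntegral_map hE (by exact hh.aestronglyMeasurable) hmF.aemeasurable, hmap,
        ← integral_indicator hE, ← integral_indicator hE,
        (hres (E.indicator h) (hh.indicator hE) (hi.indicator hE)).2]
      refine integral_congr_ae (Filter.Eventually.of_forall fun x => ?_)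
      have hEu : ∀ t, Function.update x l t ∈ E ↔ x ∈ E := fun t =>
        hEdep _ _ fun j hj => Function.update_of_ne (by simpa using hj) _ _
      by_cases hx : x ∈ E
      · simp [Set.indicator, hEu, hx, hc]
      · simp [Set.indicator, hEu, hx]
    · exact (measurable_firstVars_sigmaOf hS hcm hcdep).aestronglyMeasurable
  have key2 : ∀ᵐ x ∂Q, c x = 0 := by
    rw [← hmap]
    exact (ae_map_iff hmF.aemeasurable (hcm (measurableSet_singleton 0))).2 key
  filter_upwards [key2, (hres h hh hi).1.prod_right_ae] with x h1 h2
  exact ⟨h2, h1⟩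

end

/-! ### Mixed norms as sums over index tuples -/

section

variable {ι S : Type*} [MeasurableSpace S] {μ : Measure S} [IsProbabilityMeasure μ] [DecidableEq ι]

/-- Partial integration over index-value pairs is a sum of partial integrals. -/
theorem lmarginal_count_prod (s : Finset ι) {F : (ι → ℕ × S) → ℝ≥0∞} (hF : Measurable F)
    (z : ι → ℕ × S) :
    lmarginal (fun _ => Measure.count.prod μ) s F z =
      ∑' a : s → ℕ, lmarginal (fun _ => μ) s
        (fun x => F fun l => (Function.updateFinset (fun l => (z l).1) s a l, x l))
        fun l => (z l).2 := by
  have hmp := (measurePreserving_arrowProdEquivProdArrow ℕ S s (fun _ => Measure.count)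
    (fun _ => μ)).symm
  have hFm : Measurable fun y : s → ℕ × S => F (Function.updateFinset z s y) :=
    hF.comp measurable_updateFinset
  rw [lmarginal, ← hmp.lintegral_comp hFm]
  refine (lintegral_prod _ (hFm.comp hmp.measurable).aemeasurable).trans ?_
  rw [lintegral_countable']
  refine tsum_congr fun a => ?_
  rw [Measure.pi_singleton]
  simp only [Measure.count_singleton, Finset.prod_const_one, mul_one, lmarginal]
  refine lintegral_congr fun x => congrArg F (funext fun l => ?_)
  by_cases hl : l ∈ s <;> simp [Function.updateFinset, hl, MeasurableEquiv.arrowProdEquivProdArrow,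
    Equiv.arrowProdEquivProdArrow]

theorem lmarginal_eq_lintegral_of_dependsOn [Fintype ι] (s : Finset ι) {f : (ι → S) → ℝ≥0∞}
    (hf : Measurable f) (hdep : ∀ x y, (∀ j ∈ s, x j = y j) → f x = f y) (x : ι → S) :
    lmarginal (fun _ => μ) s f x = ∫⁻ y, f y ∂(Measure.pi fun _ : ι => μ) := by
  have h1 : lmarginal (fun _ => μ) sᶜ f = f := by
    ext y
    have : ∀ y', f (Function.updateFinset y sᶜ y') = f y := fun y' =>
      hdep _ _ fun j hj => by simp [Function.updateFinset, hj]
    simp [lmarginal, this]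
  rw [lintegral_eq_lmarginal_univ x, ← Finset.union_compl s,
    lmarginal_union _ f hf disjoint_compl_right, h1]

/-- Mixed norms of a kernel of index-value pairs in terms of sums of partial integrals. -/
theorem lmarginal_rpow_lmarginal_le [Fintype ι] (I : Finset (ι → ℕ))
    {φ : (ι → ℕ) → (ι → S) → ℝ≥0∞} (hφ : ∀ i ∈ I, Measurable (φ i)) {G : (ι → ℕ × S) → ℝ≥0∞}
    (hG : Measurable G) (hGφ : ∀ i ∈ I, ∀ x : ι → S, G (fun l => (i l, x l)) = φ i x)
    (hG0 : ∀ i ∉ I, ∀ x : ι → S, G (fun l => (i l, x l)) = 0) {σ : ℝ} (hσ : 0 ≤ σ) (J : Finset ι)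
    (z : ι → ℕ × S) :
    lmarginal (fun _ => Measure.count.prod μ) J
        (fun z => lmarginal (fun _ => Measure.count.prod μ) Jᶜ G z ^ σ) z ≤
      open Classical in
      ∑' a : J → ℕ, ∫⁻ x, (∑ i ∈ I.filter (fun i => ∀ j : J, i j = a j),
        lmarginal (fun _ => μ) Jᶜ (φ i) x) ^ σ ∂(Measure.pi fun _ : ι => μ) := by
  classical
  rw [lmarginal_count_prod J ((Measurable.lmarginal _ hG).pow_const _)]
  refine ENNReal.tsum_le_tsum fun a => ?_
  have hm : Measurable fun x : ι → S => (∑ i ∈ I.filter (fun i => ∀ j : J, i j = a j),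
      lmarginal (fun _ => μ) Jᶜ (φ i) x) ^ σ :=
    (Finset.measurable_sum _ fun i hi =>
      Measurable.lmarginal _ (hφ i (Finset.mem_filter.1 hi).1)).pow_const _
  -- Once the coordinates in `Jᶜ` are integrated out, the integrand depends on those in `J` only, so
  -- the integral over these is a full integral and the base point `z` drops out.
  rw [← lmarginal_eq_lintegral_of_dependsOn J hm _ fun l => (z l).2]
  · refine lmarginal_mono (fun x => ?_) _
    refine ENNReal.rpow_le_rpow ?_ hσ
    rw [lmarginal_count_prod Jᶜ hG]
    simp only
    set i₀ : ι → ℕ := Function.updateFinset (fun l => (z l).1) J a with hi₀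
    -- Choosing indices on `Jᶜ` amounts to choosing a full tuple that equals `a` on `J`.
    have hinj : Function.Injective fun b : (Jᶜ : Finset ι) → ℕ =>
        Function.updateFinset i₀ Jᶜ b := by
      intro b b' hbb
      ext l
      have := congrFun hbb l
      simpa [Function.updateFinset, Finset.mem_compl.1 l.2] using this
    have hval : ∀ (b : (Jᶜ : Finset ι) → ℕ) (j : J), Function.updateFinset i₀ Jᶜ b j = a j := by
      intro b j
      simp [Function.updateFinset, hi₀]
    set V : (ι → ℕ) → ℝ≥0∞ := fun i => if i ∈ I.filter (fun i => ∀ j : J, i j = a j) then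
      lmarginal (fun _ => μ) Jᶜ (φ i) x else 0 with hV
    calc _ = ∑' b : (Jᶜ : Finset ι) → ℕ, V (Function.updateFinset i₀ Jᶜ b) := by
          refine tsum_congr fun b => ?_
          by_cases hb : Function.updateFinset i₀ Jᶜ b ∈ I
          · have : Function.updateFinset i₀ Jᶜ b ∈ I.filter (fun i => ∀ j : J, i j = a j) :=
              Finset.mem_filter.2 ⟨hb, hval b⟩
            simp only [hV, this, if_true, hGφ _ hb]
          · have : Function.updateFinset i₀ Jᶜ b ∉ I.filter (fun i => ∀ j : J, i j = a j) :=
              fun h => hb (Finset.mem_filter.1 h).1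
            simp only [hV, this, if_false]
            exact (lintegral_congr fun y => hG0 _ hb _).trans lintegral_zero
      _ ≤ ∑' i, V i := ENNReal.tsum_comp_le_tsum_of_injective hinj V
      _ = ∑ i ∈ I.filter (fun i => ∀ j : J, i j = a j), V i :=
          tsum_eq_sum fun i hi => by simp only [hV, hi, if_false]
      _ = _ := Finset.sum_congr rfl fun i hi => by simp only [hV, hi, if_true]
  · intro x y hxy
    congr 1
    refine Finset.sum_congr rfl fun i _ => lmarginal_congr _ _ fun j hj => hxy j (by simpa using hj)

end

/-! ### `U`-statistics on the product space -/

theorem mem_Inc {m n : ℕ} {i : Fin m → ℕ} : i ∈ Inc m n ↔ (∀ l, i l < n) ∧ StrictMono i := by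
  classical
  simp [Inc, Fintype.mem_piFinset]

/-- The partial sums as sums over index tuples. -/
theorem partialSum_eq_sum {S : Type v} {B : Type w} [NormedAddCommGroup B] (N : ℕ)
    (h : (ℕ → ℕ × S) → B) (j : ℕ) (x : ℕ → S) (z : ℕ → ℕ × S) :
    partialSum N h j x z = ∑ i ∈ Fintype.piFinset fun _ : Fin j => Finset.range N,
      h fun l => if hl : l < j then (i ⟨l, hl⟩, x (i ⟨l, hl⟩)) else z l := by
  induction j generalizing z with
  | zero => simp [partialSum]
  | succ j ih =>
    simp only [partialSum, ih]
    rw [← Finset.sum_product']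
    refine Finset.sum_bij' (fun w _ => (Fin.snoc w.2 w.1 : Fin (j + 1) → ℕ))
      (fun i _ => (i (Fin.last j), fun l => i l.castSucc)) ?_ ?_ ?_ ?_ ?_
    · rintro ⟨k, i⟩ hw
      simp only [Finset.mem_product, Finset.mem_range, Fintype.mem_piFinset] at hw ⊢
      intro l
      refine Fin.lastCases ?_ (fun l => ?_) l
      · simpa using hw.1
      · simpa using hw.2 l
    · intro i hi
      simp only [Finset.mem_product, Finset.mem_range, Fintype.mem_piFinset] at hi ⊢
      exact ⟨hi _, fun l => hi _⟩
    · rintro ⟨k, i⟩ _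
      simp
    · intro i _
      ext l
      refine Fin.lastCases ?_ (fun l => ?_) l <;> simp
    · rintro ⟨k, i⟩ _
      congr 1
      ext1 l
      rcases lt_trichotomy l j with hl | rfl | hl
      · have e : (⟨l, by omega⟩ : Fin (j + 1)) = Fin.castSucc ⟨l, hl⟩ := rfl
        simp only [hl, dif_pos, show l < j + 1 by omega, e, Fin.snoc_castSucc]
      · have e : (⟨l, by omega⟩ : Fin (l + 1)) = Fin.last l := rfl
        simp [e]
      · simp [show ¬ l < j by omega, show ¬ l < j + 1 by omega, show l ≠ j by omega]

section

variable {S : Type v} {B : Type w} [NormedAddCommGroup B] {m : ℕ}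
  {h : (Fin m → ℕ) → (Fin m → S) → B}

theorem UStat_update (n k : ℕ) (hk : n ≤ k) (x : ℕ → S) (t : S) :
    UStat h (fun i (x : ℕ → S) => x i) n (Function.update x k t) =
      UStat h (fun i (x : ℕ → S) => x i) n x := by
  refine Finset.sum_congr rfl fun i hi => ?_
  congr 1
  ext1 l
  have := (mem_Inc.1 hi).1 l
  exact Function.update_of_ne (by omega) _ _

variable [MeasurableSpace S]

/-- The `U`-statistics of degenerate kernels form a martingale. -/
theorem UStat_martingale [NormedSpace ℝ B] [CompleteSpace B] {μ : Measure S} [IsProbabilityMeasure μ]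
    (hc : ∀ i, StrictMono i → ∀ l x, Integrable (fun t => h i (Function.update x l t)) μ ∧
      ∫ t, h i (Function.update x l t) ∂μ = 0) (n : ℕ) (x : ℕ → S) :
    Integrable (fun t => UStat h (fun i (x : ℕ → S) => x i) (n + 1) (Function.update x n t)) μ ∧
      ∫ t, UStat h (fun i (x : ℕ → S) => x i) (n + 1) (Function.update x n t) ∂μ =
        UStat h (fun i (x : ℕ → S) => x i) n x := by
  classical
  have hsub : Inc m n ⊆ Inc m (n + 1) := fun i hi =>
    mem_Inc.2 ⟨fun l => ((mem_Inc.1 hi).1 l).trans (Nat.lt_succ_self n), (mem_Inc.1 hi).2⟩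
  have hsplit : ∀ t, UStat h (fun i (x : ℕ → S) => x i) (n + 1) (Function.update x n t) =
      ∑ i ∈ Inc m (n + 1) \ Inc m n, h i (fun l => Function.update x n t (i l)) +
        UStat h (fun i (x : ℕ → S) => x i) n x := fun t => by
    rw [← UStat_update n n le_rfl x t]
    exact (Finset.sum_sdiff hsub).symm
  have hterm : ∀ i ∈ Inc m (n + 1) \ Inc m n,
      Integrable (fun t => h i (fun l => Function.update x n t (i l))) μ ∧
        ∫ t, h i (fun l => Function.update x n t (i l)) ∂μ = 0 := by
    intro i hi
    obtain ⟨h1, h2⟩ := Finset.mem_sdiff.1 hi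
    have h3 := mem_Inc.1 h1
    -- A new tuple contains the index `n`, at exactly one position by strict monotonicity; the
    -- kernel is centered in that position.
    obtain ⟨l, hl⟩ : ∃ l, i l = n := by
      by_contra hne
      push Not at hne
      exact h2 (mem_Inc.2 ⟨fun l => by have := h3.1 l; have := hne l; omega, h3.2⟩)
    have h4 : ∀ t, (fun l => Function.update x n t (i l)) =
        Function.update (fun l => x (i l)) l t := fun t => by
      ext1 l'
      by_cases hl' : l' = l
      · subst hl'
        simp [hl]
      · rw [Function.update_of_ne hl', Function.update_of_ne]
        rw [← hl]
        exact fun he => hl' (h3.2.injective he)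
    simp only [h4]
    exact hc i h3.2 l _
  simp only [hsplit]
  have hint := integrable_finsetSum (μ := μ) _ fun i hi => (hterm i hi).1
  refine ⟨hint.add (integrable_const _), ?_⟩
  rw [integral_add hint (integrable_const _), integral_finsetSum _ fun i hi => (hterm i hi).1,
    Finset.sum_eq_zero fun i hi => (hterm i hi).2]
  simp

theorem measurable_UStat [MeasurableSpace B] [BorelSpace B] [SecondCountableTopology B]
    (hm : ∀ i, StrictMono i → Measurable (h i)) (n : ℕ) :
    Measurable (UStat h (fun i (x : ℕ → S) => x i) n) :=
  Finset.measurable_sum _ fun i hi => (hm i (mem_Inc.1 hi).2).comp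
    (measurable_pi_iff.2 fun l => measurable_pi_apply (i l))

end

/-- Passing from coordinates indexed by `ℕ` to coordinates indexed by `Fin m`. -/
theorem sum_powerset_lmarginal_eq {Z : Type*} [MeasurableSpace Z] (lam : Measure Z) [SigmaFinite lam]
    {m : ℕ} {G : (Fin m → Z) → ℝ≥0∞} (hG : Measurable G) (σ : ℝ) (z : ℕ → Z) :
    ∑ J ∈ (Finset.range m).powerset, lmarginal (fun _ : ℕ => lam) J
      (fun z => lmarginal (fun _ : ℕ => lam) (Finset.range m \ J)
        (fun z => G fun l => z l) z ^ σ) z =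
    ∑ J : Finset (Fin m), lmarginal (fun _ : Fin m => lam) J
      (fun z => lmarginal (fun _ : Fin m => lam) Jᶜ G z ^ σ) fun l => z l := by
  have himg : ∀ (J : Finset (Fin m)) {f : (Fin m → Z) → ℝ≥0∞}, Measurable f → ∀ z : ℕ → Z,
      lmarginal (fun _ : ℕ => lam) (J.image Fin.val) (fun z => f fun l => z l) z =
        lmarginal (fun _ : Fin m => lam) J f fun l => z l := fun J f hf z =>
    lmarginal_image (X := fun _ : ℕ => Z) (μ := fun _ : ℕ => lam) (e := (Fin.val : Fin m → ℕ))
      Fin.val_injective J hf z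
  symm
  refine Finset.sum_bij (fun J _ => J.image Fin.val) ?_ ?_ ?_ ?_
  · intro J _
    rw [Finset.mem_powerset]
    intro i hi
    obtain ⟨l, -, rfl⟩ := Finset.mem_image.1 hi
    exact Finset.mem_range.2 l.2
  · intro J _ J' _ hJ
    exact Finset.image_injective Fin.val_injective hJ
  · intro J hJ
    refine ⟨Finset.univ.filter fun l => (l : ℕ) ∈ J, Finset.mem_univ _, ?_⟩
    ext i
    simp only [Finset.mem_image, Finset.mem_filter, Finset.mem_univ, true_and]
    constructor
    · rintro ⟨l, hl, rfl⟩
      exact hl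
    · exact fun hi => ⟨⟨i, Finset.mem_range.1 (Finset.mem_powerset.1 hJ hi)⟩, hi, rfl⟩
  · intro J _
    have hcompl : Finset.range m \ J.image Fin.val = Jᶜ.image Fin.val := by
      ext i
      simp only [Finset.mem_sdiff, Finset.mem_range, Finset.mem_image, Finset.mem_compl]
      constructor
      · rintro ⟨h1, h2⟩
        exact ⟨⟨i, h1⟩, fun h3 => h2 ⟨_, h3, rfl⟩, rfl⟩
      · rintro ⟨l, hl, rfl⟩
        exact ⟨l.2, fun ⟨l', hl', he⟩ => hl (Fin.val_injective he ▸ hl')⟩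
    rw [hcompl, ← himg J ((Measurable.lmarginal _ hG).pow_const σ)]
    simp only [himg Jᶜ hG]

/-- The moment inequality on a product space, with all mixed norms of the kernels. -/
theorem exists_UStat_moment {B : Type w} [NormedAddCommGroup B] [NormedSpace ℝ B]
    [CompleteSpace B] [MeasurableSpace B] [BorelSpace B] [SecondCountableTopology B]
    {r p q : ℝ} (hB : IsRSmooth B r) (hp1 : 1 < p) (hpr : p ≤ r) (hr2 : r ≤ 2) (hpq : p ≤ q)
    (m : ℕ) :
    ∃ K : ℝ≥0, ∀ (S : Type v) [MeasurableSpace S] (μ : Measure S) [IsProbabilityMeasure μ]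
      (h : (Fin m → ℕ) → (Fin m → S) → B), (∀ i, StrictMono i → Measurable (h i)) →
      (∀ i, StrictMono i → ∀ l x, Integrable (fun t => h i (Function.update x l t)) μ ∧
        ∫ t, h i (Function.update x l t) ∂μ = 0) → ∀ N : ℕ,
      ∫⁻ x, (Finset.Icc m N).sup (fun n => ‖UStat h (fun i (x : ℕ → S) => x i) n x‖ₑ ^ q)
          ∂(Measure.infinitePi fun _ : ℕ => μ) ≤
        open Classical in
        K * ∑ J : Finset (Fin m), ∑' a : J → ℕ,
          ∫⁻ x, (∑ i ∈ (Inc m N).filter (fun i => ∀ j : J, i j = a j),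
            lmarginal (fun _ => μ) Jᶜ (fun x => ‖h i x‖ₑ ^ p) x) ^ (q / p)
            ∂(Measure.pi fun _ : Fin m => μ) := by
  classical
  obtain ⟨nu, ⟨a, b, ha, hb, hab⟩, C, hC, h2⟩ := hB.exists_two_point hp1 hpr hr2
  have hp0 : 0 < p := by linarith
  have hq1 : 1 < q := by linarith
  have hq0 : 0 < q := by linarith
  have hσ : 1 ≤ q / p := by rwa [le_div_iff₀ hp0, one_mul]
  have hnu : Continuous nu := by
    refine Seminorm.continuous_of_le (q := b.toNNReal • normSeminorm ℝ B) ?_ fun x => ?_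
    · exact (continuous_norm.const_smul b.toNNReal)
    · simpa [NNReal.smul_def, Real.coe_toNNReal _ hb.le] using (hab x).2
  obtain ⟨K₁, hK₁⟩ := exists_doob.{v} q hq1
  obtain ⟨K₂, hK₂⟩ := Seminorm.exists_partialSum_moment.{v, w} hnu hp1 (hpr.trans hr2) hC h2
    (q / p) hσ
  have hlow : ∀ x : B, ‖x‖ₑ ≤ (a⁻¹).toNNReal * ENNReal.ofReal (nu x) := fun x => by
    rw [← ofReal_norm, ← ENNReal.ofReal, ← ENNReal.ofReal_mul (by positivity)]
    refine ENNReal.ofReal_le_ofReal ?_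
    rw [inv_mul_eq_div, le_div_iff₀ ha, mul_comm]
    exact (hab x).1
  have hup : ∀ x : B, nu.epow p x ≤ (b.toNNReal ^ p : ℝ≥0) * ‖x‖ₑ ^ p := fun x => by
    rw [ENNReal.coe_rpow_of_nonneg _ hp0.le, ← ENNReal.mul_rpow_of_nonneg _ _ hp0.le]
    refine ENNReal.rpow_le_rpow ?_ hp0.le
    rw [← ofReal_norm, ← ENNReal.ofReal, ← ENNReal.ofReal_mul hb.le]
    exact ENNReal.ofReal_le_ofReal (hab x).2
  -- The factors are the equivalence of norms from below, Doob, one Rosenthal constant per argument,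
  -- and the equivalence of norms from above.
  refine ⟨(a⁻¹).toNNReal ^ q * K₁ * K₂ ^ m * (b.toNNReal ^ p) ^ (q / p),
    fun S _ μ _ h hm hc N => ?_⟩
  set U := UStat h (fun i (x : ℕ → S) => x i) with hU
  set P := Measure.infinitePi fun _ : ℕ => μ with hP
  set lam : Measure (ℕ × S) := Measure.count.prod μ with hlam
  have hUm : ∀ n, Measurable (U n) := measurable_UStat hm
  have hS : Nonempty S := nonempty_of_isProbabilityMeasure μ
  obtain ⟨s₀⟩ := hS
  -- the maximal inequality
  have hmax : ∫⁻ x, (Finset.Icc m N).sup (fun n => ‖U n x‖ₑ ^ q) ∂P ≤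
      ((a⁻¹).toNNReal ^ q * K₁ : ℝ≥0) * ∫⁻ x, nu.epow p (U N x) ^ (q / p) ∂P := by
    have hdoob := hK₁ S μ (fun n x => ENNReal.ofReal (nu (U n x)))
      (fun n => ENNReal.measurable_ofReal.comp (hnu.measurable.comp (hUm n)))
      (fun n x k t hk => by simp only [hU, UStat_update n k hk x t])
      (fun n x => by
        obtain ⟨h3, h4⟩ := UStat_martingale hc n x
        have h5 := Seminorm.ofReal_integral_le hnu h3
        rwa [h4] at h5) N
    calc ∫⁻ x, (Finset.Icc m N).sup (fun n => ‖U n x‖ₑ ^ q) ∂P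
        ≤ ∫⁻ x, ((a⁻¹).toNNReal ^ q : ℝ≥0) *
          ((Finset.range (N + 1)).sup fun n => ENNReal.ofReal (nu (U n x))) ^ q ∂P := by
          refine lintegral_mono fun x => Finset.sup_le fun n hn => ?_
          rw [ENNReal.coe_rpow_of_nonneg _ hq0.le, ← ENNReal.mul_rpow_of_nonneg _ _ hq0.le]
          refine ENNReal.rpow_le_rpow ((hlow _).trans ?_) hq0.le
          gcongr
          exact Finset.le_sup (f := fun n => ENNReal.ofReal (nu (U n x)))
            (Finset.mem_range.2 (Nat.lt_succ_of_le (Finset.mem_Icc.1 hn).2))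
      _ ≤ _ := by
          rw [lintegral_const_mul' _ _ ENNReal.coe_ne_top, ENNReal.coe_mul, mul_assoc]
          refine mul_le_mul_right (hdoob.trans (le_of_eq ?_)) _
          congr 1
          refine lintegral_congr fun x => ?_
          rw [Seminorm.epow, ← ENNReal.rpow_mul, mul_div_cancel₀ _ hp0.ne']
  -- the kernel as a function of index-value pairs
  set H : (Fin m → ℕ × S) → B := fun z =>
    if (fun l => (z l).1) ∈ Inc m N then h (fun l => (z l).1) (fun l => (z l).2) else 0 with hH
  have hHm : Measurable H := by
    have h1 : Measurable fun w : (Fin m → S) × (Fin m → ℕ) =>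
        if w.2 ∈ Inc m N then h w.2 w.1 else 0 := by
      refine measurable_from_prod_countable_left fun i => ?_
      by_cases hi : i ∈ Inc m N
      · simpa only [hi, if_true] using hm i (mem_Inc.1 hi).2
      · simp only [hi, if_false]
        exact measurable_const
    have h3 : Measurable fun z : Fin m → ℕ × S => ((fun l => (z l).2, fun l => (z l).1) :
        (Fin m → S) × (Fin m → ℕ)) :=
      (measurable_pi_iff.2 fun l => measurable_snd.comp (measurable_pi_apply l)).prodMk
        (measurable_pi_iff.2 fun l => measurable_fst.comp (measurable_pi_apply l))
    exact h1.comp h3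
  have hrestr : Measurable fun (z : ℕ → ℕ × S) (l : Fin m) => z l :=
    measurable_pi_iff.2 fun l => measurable_pi_apply (l : ℕ)
  -- With `j = m` and `I = ∅` all arguments of the kernel are summed over, so the base point `(0,
  -- s₀)` is a dummy.
  have hT := hK₂ S μ m N (fun z => H fun l => z l) (hHm.comp hrestr) ?_ ?_ m le_rfl ∅ (by simp)
    fun _ => (0, s₀)
  rotate_left
  · intro z l hl hle
    have : (fun l : Fin m => (z l).1) ∉ Inc m N := fun hmem => by
      have h3 := (mem_Inc.1 hmem).2 (show (⟨l, by omega⟩ : Fin m) < ⟨l + 1, hl⟩ from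
        Nat.lt_succ_self l)
      exact absurd h3 (not_lt.2 hle)
    simp only [hH, this, if_false]
  · intro z l k hl
    have h3 : ∀ t, (fun l' : Fin m => (Function.update z l (k, t) l').1) =
        Function.update (fun l' : Fin m => (z l').1) ⟨l, hl⟩ k := fun t => by
      ext1 l'
      by_cases hl' : l' = ⟨l, hl⟩
      · subst hl'; simp
      · have : (l' : ℕ) ≠ l := fun he => hl' (Fin.ext he)
        simp [hl', this]
    have h4 : ∀ t, (fun l' : Fin m => (Function.update z l (k, t) l').2) =
        Function.update (fun l' : Fin m => (z l').2) ⟨l, hl⟩ t := fun t => by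
      ext1 l'
      by_cases hl' : l' = ⟨l, hl⟩
      · subst hl'; simp
      · have : (l' : ℕ) ≠ l := fun he => hl' (Fin.ext he)
        simp [hl', this]
    simp only [hH, h3, h4]
    by_cases hi : Function.update (fun l' : Fin m => (z l').1) ⟨l, hl⟩ k ∈ Inc m N
    · simp only [hi, if_true]
      exact hc _ (mem_Inc.1 hi).2 _ _
    · simp [hi]
  have hclosed : ∀ x, partialSum N (fun z => H fun l => z l) m x (fun _ => (0, s₀)) = U N x := by
    intro x
    rw [partialSum_eq_sum, hU]
    simp only [UStat, hH, Fin.is_lt, dif_pos, Fin.eta]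
    rw [← Finset.sum_filter]
    refine Finset.sum_congr ?_ fun _ _ => rfl
    ext i
    simp only [Finset.mem_filter, Fintype.mem_piFinset, Finset.mem_range, mem_Inc]
    tauto
  simp only [lmarginal_empty, hclosed, Finset.union_empty] at hT
  -- from the seminorm to the norm
  have hnorm : ∀ J : Finset ℕ, lmarginal (fun _ => lam) J (fun z => lmarginal (fun _ => lam)
      (Finset.range m \ J) (fun z => nu.epow p (H fun l => z l)) z ^ (q / p)) (fun _ => (0, s₀)) ≤
      ((b.toNNReal ^ p) ^ (q / p) : ℝ≥0) * lmarginal (fun _ => lam) J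
        (fun z => lmarginal (fun _ => lam) (Finset.range m \ J)
          (fun z => ‖H fun l => z l‖ₑ ^ p) z ^ (q / p)) (fun _ => (0, s₀)) := by
    intro J
    have hσ0 : 0 ≤ q / p := by linarith
    have h3 : ∀ z, lmarginal (fun _ => lam) (Finset.range m \ J)
        (fun z => nu.epow p (H fun l => z l)) z ≤ (b.toNNReal ^ p : ℝ≥0) *
        lmarginal (fun _ => lam) (Finset.range m \ J) (fun z => ‖H fun l => z l‖ₑ ^ p) z := by
      intro z
      simp only [lmarginal]
      rw [← lintegral_const_mul' _ _ ENNReal.coe_ne_top]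
      exact lintegral_mono fun y => hup _
    rw [lmarginal, lmarginal, ← lintegral_const_mul' _ _ ENNReal.coe_ne_top]
    refine lintegral_mono fun y => ?_
    rw [ENNReal.coe_rpow_of_nonneg _ hσ0, ← ENNReal.mul_rpow_of_nonneg _ _ hσ0]
    exact ENNReal.rpow_le_rpow (h3 _) hσ0
  have hGm : Measurable fun z : Fin m → ℕ × S => ‖H z‖ₑ ^ p := hHm.enorm.pow_const p
  have hsum := sum_powerset_lmarginal_eq lam hGm (q / p) fun _ => (0, s₀)
  set R := ∑ J : Finset (Fin m), ∑' a : J → ℕ,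
    ∫⁻ x, (∑ i ∈ (Inc m N).filter (fun i => ∀ j : J, i j = a j),
      lmarginal (fun _ => μ) Jᶜ (fun x => ‖h i x‖ₑ ^ p) x) ^ (q / p)
      ∂(Measure.pi fun _ : Fin m => μ) with hR
  have hfin : ∑ J : Finset (Fin m), lmarginal (fun _ => lam) J
      (fun z => lmarginal (fun _ => lam) Jᶜ (fun z => ‖H z‖ₑ ^ p) z ^ (q / p))
        (fun _ => (0, s₀)) ≤ R := by
    refine Finset.sum_le_sum fun J _ => ?_
    refine (lmarginal_rpow_lmarginal_le (Inc m N) (φ := fun i x => ‖h i x‖ₑ ^ p)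
      (fun i hi => (hm i (mem_Inc.1 hi).2).enorm.pow_const p) hGm (fun i hi x => ?_)
      (fun i hi x => ?_) (by linarith) J _).trans (le_of_eq ?_)
    · simp only [hH, hi, if_true]
    · simp [hH, hi, hp0]
    · congr!
  calc _ ≤ ((a⁻¹).toNNReal ^ q * K₁ : ℝ≥0) * ∫⁻ x, nu.epow p (U N x) ^ (q / p) ∂P := hmax
    _ ≤ ((a⁻¹).toNNReal ^ q * K₁ : ℝ≥0) * (K₂ ^ m * (((b.toNNReal ^ p) ^ (q / p) : ℝ≥0) * R)) := by
        gcongr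
        refine hT.trans (mul_le_mul_right ((Finset.sum_le_sum fun J _ => hnorm J).trans ?_) _)
        rw [← Finset.mul_sum, hsum]
        exact mul_le_mul_right hfin _
    _ = _ := by
        push_cast
        ring

/-! ### Return to the i.i.d. sequence: mixed moments -/

section

variable {Ω : Type u} [MeasurableSpace Ω] {P : Measure Ω} [IsProbabilityMeasure P]
  {S : Type v} [MeasurableSpace S] {ξ : ℕ → Ω → S} {B : Type w} [NormedAddCommGroup B]
  {m : ℕ} {h : (Fin m → ℕ) → (Fin m → S) → B} {p q : ℝ}

/-- The sum over all `a` of the `q / p`-th moments of `condMomentSum`. -/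
noncomputable def mixedMoment (h : (Fin m → ℕ) → (Fin m → S) → B) (ξ : ℕ → Ω → S) (P : Measure Ω)
    (N : ℕ) (p q : ℝ) (J : Finset (Fin m)) : ℝ≥0∞ :=
  ∑' a : J → ℕ, ∫⁻ ω, condMomentSum h ξ P N p J a ω ^ (q / p) ∂P

/-- At most one tuple agrees with `a` everywhere, and conditioning on all variables does nothing, so
the powers `p` and `q / p` combine to `q`. -/
theorem mixedMoment_univ_le [MeasurableSpace B] [OpensMeasurableSpace B] (hξ : IsIIDSeq ξ P) (hm : ∀ i, StrictMono i → Measurable (h i))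
    (hp : 0 < p) (hq : 0 < q) (N : ℕ) :
    mixedMoment h ξ P N p q Finset.univ ≤ sumMoments h ξ P N q := by
  classical
  set V : (Fin m → ℕ) → ℝ≥0∞ := fun i =>
    if i ∈ Inc m N then ∫⁻ ω, ‖h i (firstVars ξ m ω)‖ₑ ^ q ∂P else 0 with hV
  have hinj : Function.Injective fun (a : ↥(Finset.univ : Finset (Fin m)) → ℕ) (l : Fin m) =>
      a ⟨l, Finset.mem_univ l⟩ := fun a b hab => funext fun l => congrFun hab l
  calc mixedMoment h ξ P N p q Finset.univ
      ≤ ∑' a : (↥(Finset.univ : Finset (Fin m)) → ℕ), V fun l => a ⟨l, Finset.mem_univ l⟩ := by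
        refine ENNReal.tsum_le_tsum fun a => ?_
        by_cases ha : (fun l => a ⟨l, Finset.mem_univ l⟩) ∈ Inc m N
        · have hfil : (Inc m N).filter (fun i => ∀ j : ↥(Finset.univ : Finset (Fin m)), i j = a j) =
              {fun l => a ⟨l, Finset.mem_univ l⟩} := by
            ext i
            simp only [Finset.mem_filter, Finset.mem_singleton]
            constructor
            · exact fun hi => funext fun l => hi.2 ⟨l, Finset.mem_univ l⟩
            · rintro rfl
              exact ⟨ha, fun _ => rfl⟩
          simp only [hV, ha, if_true]
          refine lintegral_mono_ae ?_
          have hce := hξ.condLExp_eq Finset.univ ((hm _ (mem_Inc.1 ha).2).enorm.pow_const p)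
          filter_upwards [hce] with ω hω
          have : condMomentSum h ξ P N p Finset.univ a ω = ‖h (fun l => a ⟨l, Finset.mem_univ l⟩)
              (firstVars ξ m ω)‖ₑ ^ p := by
            rw [condMomentSum]
            convert hω using 1
            · rw [← Finset.sum_singleton (fun i => condLExp (sigmaOf ξ Finset.univ) P
                (fun ω' => ‖h i (firstVars ξ m ω')‖ₑ ^ p) ω), ← hfil]
            · simp
          rw [this, ← ENNReal.rpow_mul, mul_div_cancel₀ _ hp.ne']
        · have hfil : ∀ i ∈ Inc m N, ¬ ∀ j : ↥(Finset.univ : Finset (Fin m)), i j = a j :=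
            fun i hi hia => ha (by
              have : (fun l => a ⟨l, Finset.mem_univ l⟩) = i :=
                funext fun l => (hia ⟨l, Finset.mem_univ l⟩).symm
              rwa [this])
          have : ∀ ω, condMomentSum h ξ P N p Finset.univ a ω = 0 := fun ω => by
            rw [condMomentSum, Finset.filter_false_of_mem hfil, Finset.sum_empty]
          simp [this, hp, hq]
    _ ≤ ∑' i, V i := ENNReal.tsum_comp_le_tsum_of_injective hinj V
    _ = ∑ i ∈ Inc m N, V i := tsum_eq_sum fun i hi => by simp only [hV, hi, if_false]
    _ = _ := Finset.sum_congr rfl fun i hi => by simp only [hV, hi, if_true]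

/-- Conditioning on no variable is taking the expectation, and there is a single function `a` on the
empty set. -/
theorem mixedMoment_empty_le [MeasurableSpace B] [OpensMeasurableSpace B] (hξ : IsIIDSeq ξ P) (hm : ∀ i, StrictMono i → Measurable (h i))
    (N : ℕ) : mixedMoment h ξ P N p q ∅ ≤ sumMoments h ξ P N p ^ (q / p) := by
  classical
  have := hξ.isProbabilityMeasure
  have hmF := hξ.measurable_firstVars (m := m)
  have hae : ∀ a, ∀ᵐ ω ∂P, condMomentSum h ξ P N p ∅ a ω = sumMoments h ξ P N p := by
    intro a
    have h1 : ∀ i ∈ Inc m N, ∀ᵐ ω ∂P, condLExp (sigmaOf ξ (∅ : Finset (Fin m))) P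
        (fun ω' => ‖h i (firstVars ξ m ω')‖ₑ ^ p) ω = ∫⁻ ω, ‖h i (firstVars ξ m ω)‖ₑ ^ p ∂P := by
      intro i hi
      have hfm := (hm i (mem_Inc.1 hi).2).enorm.pow_const p
      filter_upwards [hξ.condLExp_eq ∅ hfm] with ω hω
      rw [hω, Finset.compl_empty, lmarginal_univ, ← Measure.infinitePi_eq_pi, ← hξ.map_firstVars,
        lintegral_map hfm hmF]
    filter_upwards [(Finset.eventually_all _).2 h1] with ω hω
    rw [condMomentSum, sumMoments, Finset.filter_true_of_mem fun i _ j => absurd j.2 (Finset.notMem_empty _)]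
    exact Finset.sum_congr rfl hω
  rw [mixedMoment]
  calc ∑' a : (↥(∅ : Finset (Fin m)) → ℕ), ∫⁻ ω, condMomentSum h ξ P N p ∅ a ω ^ (q / p) ∂P
      = ∑' a : (↥(∅ : Finset (Fin m)) → ℕ), sumMoments h ξ P N p ^ (q / p) := by
        refine tsum_congr fun a => ?_
        rw [lintegral_congr_ae (g := fun _ => sumMoments h ξ P N p ^ (q / p))
          (by filter_upwards [hae a] with ω hω; rw [hω])]
        simp
    _ ≤ _ := by rw [tsum_fintype]; simp

/-- For `q = p` the outer power is `1`: the conditioning disappears on integration, and each tuple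
is counted for exactly one `a`. Hence every `J` contributes the same amount. -/
theorem mixedMoment_self_eq (hξ : IsIIDSeq ξ P) (hp : 0 < p) (N : ℕ) (J : Finset (Fin m)) :
    mixedMoment h ξ P N p p J = sumMoments h ξ P N p := by
  classical
  have h1 : ∀ a : J → ℕ, ∫⁻ ω, condMomentSum h ξ P N p J a ω ^ (p / p) ∂P =
      ∑ i ∈ Inc m N, if a = (fun j : J => i j) then
        ∫⁻ ω, ‖h i (firstVars ξ m ω)‖ₑ ^ p ∂P else 0 := by
    intro a
    simp only [div_self hp.ne', ENNReal.rpow_one, condMomentSum]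
    rw [lintegral_finsetSum _ fun i _ => measurable_condLExp' _ _ _, Finset.sum_filter]
    refine Finset.sum_congr rfl fun i _ => ?_
    have : (∀ j : J, i j = a j) ↔ a = fun j : J => i j := by
      rw [funext_iff]
      exact forall_congr' fun j => eq_comm
    rw [lintegral_condLExp (hm := hξ.sigmaOf_le J)]
    simp only [this]
  rw [mixedMoment, tsum_congr h1, Summable.tsum_finsetSum fun i _ => ENNReal.summable]
  exact Finset.sum_congr rfl fun i _ => tsum_ite_eq _ _

/-- The moment inequality with all mixed moments on the right-hand side. -/
theorem exists_maxMoment_le {B : Type w} [NormedAddCommGroup B] [NormedSpace ℝ B]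
    [CompleteSpace B] [MeasurableSpace B] [BorelSpace B] [SecondCountableTopology B]
    {r p q : ℝ} (hB : IsRSmooth B r) (hp1 : 1 < p) (hpr : p ≤ r) (hr2 : r ≤ 2) (hpq : p ≤ q)
    (m : ℕ) :
    ∃ K : ℝ≥0, ∀ (Ω : Type u) [MeasurableSpace Ω] (P : Measure Ω) [IsProbabilityMeasure P]
      (S : Type v) [MeasurableSpace S] (ξ : ℕ → Ω → S) (_ : IsIIDSeq ξ P)
      (h : (Fin m → ℕ) → (Fin m → S) → B) (_ : ∀ i, StrictMono i → Measurable (h i))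
      (_ : ∀ i, StrictMono i → IsDegenerated (h i) ξ P) (N : ℕ),
      maxMoment h ξ P N q ≤ K * ∑ J : Finset (Fin m), mixedMoment h ξ P N p q J := by
  classical
  obtain ⟨K, hK⟩ := exists_UStat_moment.{v, w} hB hp1 hpr hr2 hpq m
  refine ⟨K, fun Ω _ P _ S _ ξ hξ h hm hd N => ?_⟩
  have := hξ.isProbabilityMeasure
  have hmF := hξ.measurable_firstVars (m := m)
  set μ := P.map (ξ 0) with hμ
  -- Kernels are replaced by versions centered everywhere, as the estimate on the product space
  -- demands.
  have hex : ∀ i, ∃ h' : (Fin m → S) → B, StrictMono i → Measurable h' ∧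
      h' =ᵐ[Measure.infinitePi fun _ : Fin m => μ] h i ∧
      ∀ l x, Integrable (fun t => h' (Function.update x l t)) μ ∧
        ∫ t, h' (Function.update x l t) ∂μ = 0 := by
    intro i
    by_cases hi : StrictMono i
    · obtain ⟨h', h1⟩ := exists_ae_eq_centered (hm i hi) ((hd i hi).ae_centered hξ (hm i hi))
      exact ⟨h', fun _ => h1⟩
    · exact ⟨0, fun h => absurd h hi⟩
  choose h' hh' using hex
  have hm' : ∀ i, StrictMono i → Measurable (h' i) := fun i hi => (hh' i hi).1
  have key := hK S μ h' hm' (fun i hi => (hh' i hi).2.2) N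
  have hξm : Measurable fun ω i => ξ i ω := measurable_pi_iff.2 hξ.measurable
  have hleft : maxMoment h ξ P N q = ∫⁻ x, (Finset.Icc m N).sup
      (fun n => ‖UStat h' (fun i (x : ℕ → S) => x i) n x‖ₑ ^ q)
      ∂(Measure.infinitePi fun _ : ℕ => μ) := by
    have hsup : Measurable fun x => (Finset.Icc m N).sup
        (fun n => ‖UStat h' (fun i (x : ℕ → S) => x i) n x‖ₑ ^ q) := by
      simp only [Finset.sup_eq_iSup]
      exact Measurable.iSup fun n => Measurable.iSup fun _ =>
        (measurable_UStat hm' n).enorm.pow_const q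
    have hmap := hξ.map_comp (i := fun i : ℕ => i) Function.injective_id
    rw [← hμ] at hmap
    rw [← hmap, lintegral_map hsup hξm, maxMoment]
    refine lintegral_congr_ae ?_
    -- An increasing tuple is injective, so the variables it selects have the product law and do not
    -- see the null set on which the kernels differ.
    have hU : ∀ n, ∀ᵐ ω ∂P, UStat h ξ n ω =
        UStat h' (fun i (x : ℕ → S) => x i) n fun i => ξ i ω := by
      intro n
      have h1 : ∀ i ∈ Inc m n, ∀ᵐ ω ∂P, h i (fun l => ξ (i l) ω) = h' i fun l => ξ (i l) ω := by
        intro i hi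
        have hi' := (mem_Inc.1 hi).2
        have h2 := (hh' i hi').2.1
        rw [hμ, ← hξ.map_comp hi'.injective] at h2
        have h3 := ae_of_ae_map
          (measurable_pi_iff.2 fun l => hξ.measurable (i l)).aemeasurable h2
        filter_upwards [h3] with ω hω
        exact hω.symm
      filter_upwards [(Finset.eventually_all _).2 h1] with ω hω
      exact Finset.sum_congr rfl hω
    filter_upwards [ae_all_iff.2 hU] with ω hω
    simp only [hω]
  rw [hleft]
  refine key.trans (mul_le_mul_right (Finset.sum_le_sum fun J _ => ENNReal.tsum_le_tsum fun a => ?_) _)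
  rw [← Measure.infinitePi_eq_pi, hμ, ← hξ.map_firstVars]
  rw [lintegral_map ((Finset.measurable_sum _ fun i hi => Measurable.lmarginal _
    ((hm' i (mem_Inc.1 (Finset.mem_filter.1 hi).1).2).enorm.pow_const p)).pow_const _) hmF]
  refine (lintegral_congr_ae ?_).le
  have h1 : ∀ i ∈ Inc m N, ∀ᵐ ω ∂P,
      lmarginal (fun _ => μ) Jᶜ (fun x => ‖h' i x‖ₑ ^ p) (firstVars ξ m ω) =
      condLExp (sigmaOf ξ J) P (fun ω' => ‖h i (firstVars ξ m ω')‖ₑ ^ p) ω := by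
    intro i hi
    have hi' := (mem_Inc.1 hi).2
    have h2 := (hh' i hi').2.1
    rw [hμ, ← hξ.map_firstVars] at h2
    have h3 : (fun ω => ‖h' i (firstVars ξ m ω)‖ₑ ^ p) =ᵐ[P]
        fun ω => ‖h i (firstVars ξ m ω)‖ₑ ^ p := by
      filter_upwards [ae_of_ae_map hmF.aemeasurable h2] with ω hω
      rw [hω]
    filter_upwards [hξ.condLExp_eq J ((hm' i hi').enorm.pow_const p),
      condLExp_congr_ae (mΩ := sigmaOf ξ J) h3] with ω h4 h5
    rw [← h5, h4]
  filter_upwards [(Finset.eventually_all _).2 h1] with ω hω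
  rw [condMomentSum]
  congr 1
  refine Finset.sum_congr (by congr!) fun i hi => hω i (Finset.mem_filter.1 hi).1

end

/-! ### Conclusion -/

theorem sum_finset_le_proper {m : ℕ} (hm : 1 ≤ m) (f : Finset (Fin m) → ℝ≥0∞) :
    ∑ J, f J ≤ f Finset.univ + ∑ J : Finset (Fin m) with J.Nonempty ∧ J ≠ Finset.univ, f J +
      f ∅ := by
  have : Nonempty (Fin m) := ⟨⟨0, hm⟩⟩
  rw [← Finset.sum_filter_add_sum_filter_not Finset.univ
    fun J : Finset (Fin m) => J.Nonempty ∧ J ≠ Finset.univ]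
  have h1 : ∑ J : Finset (Fin m) with ¬(J.Nonempty ∧ J ≠ Finset.univ), f J ≤
      f Finset.univ + f ∅ := by
    rw [← Finset.sum_pair Finset.univ_nonempty.ne_empty]
    refine Finset.sum_le_sum_of_subset fun J hJ => ?_
    have := (Finset.mem_filter.1 hJ).2
    rw [not_and_or, Finset.not_nonempty_iff_eq_empty, not_not] at this
    simpa [or_comm] using this
  calc _ ≤ _ := add_le_add_right h1 _
    _ = _ := by ring

theorem mainTheorem4
    (B : Type w) [NormedAddCommGroup B] [NormedSpace ℝ B] [CompleteSpace B]
    [TopologicalSpace.SeparableSpace B] [MeasurableSpace B] [BorelSpace B]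
    (r : ℝ) (hr1 : 1 < r) (hr2 : r ≤ 2) (hB : IsRSmooth B r)
    (m : ℕ) (hm : 1 ≤ m) (p : ℝ) (hp1 : 1 < p) (hpr : p ≤ r) :
    (∀ q : ℝ, p ≤ q → ∃ K : ℝ≥0,
      ∀ (Ω : Type u) [MeasurableSpace Ω] (P : Measure Ω) [IsProbabilityMeasure P]
        (S : Type v) [MeasurableSpace S] (ξ : ℕ → Ω → S) (_ : IsIIDSeq ξ P)
        (h : (Fin m → ℕ) → (Fin m → S) → B)
        (_ : ∀ i, StrictMono i → Measurable (h i))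
        (_ : ∀ i, StrictMono i → IsDegenerated (h i) ξ P)
        (N : ℕ) (_ : m ≤ N),
        maxMoment h ξ P N q ≤
          K * sumMoments h ξ P N q
          + K * ∑ J : Finset (Fin m) with J.Nonempty ∧ J ≠ Finset.univ,
              ∑' a : J → ℕ, ∫⁻ ω, condMomentSum h ξ P N p J a ω ^ (q / p) ∂P
          + K * sumMoments h ξ P N p ^ (q / p)) ∧
    (∃ K : ℝ≥0,
      ∀ (Ω : Type u) [MeasurableSpace Ω] (P : Measure Ω) [IsProbabilityMeasure P]
        (S : Type v) [MeasurableSpace S] (ξ : ℕ → Ω → S) (_ : IsIIDSeq ξ P)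
        (h : (Fin m → ℕ) → (Fin m → S) → B)
        (_ : ∀ i, StrictMono i → Measurable (h i))
        (_ : ∀ i, StrictMono i → IsDegenerated (h i) ξ P)
        (N : ℕ) (_ : m ≤ N),
        maxMoment h ξ P N p ≤ K * sumMoments h ξ P N p) := by
  have hmB : SecondCountableTopology B := UniformSpace.secondCountable_of_separable B
  refine ⟨fun q hpq => ?_, ?_⟩
  · obtain ⟨K, hK⟩ := exists_maxMoment_le.{u, v, w} hB hp1 hpr hr2 hpq m
    refine ⟨K, fun Ω _ P _ S _ ξ hξ h hh hd N _ => ?_⟩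
    refine (hK Ω P S ξ hξ h hh hd N).trans ?_
    rw [← mul_add, ← mul_add]
    refine mul_le_mul_right ((sum_finset_le_proper hm _).trans ?_) _
    exact add_le_add (add_le_add (mixedMoment_univ_le hξ hh (by linarith) (by linarith) N) le_rfl)
      (mixedMoment_empty_le hξ hh N)
  · obtain ⟨K, hK⟩ := exists_maxMoment_le.{u, v, w} hB hp1 hpr hr2 le_rfl m
    -- For `q = p` all subsets `J` give the same term, so the constant is multiplied by their
    -- number.
    refine ⟨K * (Finset.univ : Finset (Finset (Fin m))).card,
      fun Ω _ P _ S _ ξ hξ h hh hd N _ => ?_⟩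
    refine (hK Ω P S ξ hξ h hh hd N).trans (le_of_eq ?_)
    simp only [mixedMoment_self_eq hξ (by linarith : 0 < p) N, Finset.sum_const, nsmul_eq_mul]
    push_cast
    ring
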